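/- **Definitions.** A *complete discrete valuation field* is a field $F$ that is complete with respect to some surjective discrete valuation $\nu_F:F^\times\to\mathbb Z$; this valuation is unique, and $\mathcal O_F$, $\overline F$ denote its ring of integers and residue field. The *complete discrete valuation dimension* $\operatorname{cdvdim}F\in\mathbb N\cup\{\infty\}$ is $0$ if $F$ is not a complete discrete valuation field and $\operatorname{cdvdim}\overline F+1$ if it is (and $\infty$ if the sequence of successive residue fields never terminates). A field embedding $i:F\to L$ between fields of $\operatorname{cdvdim}\ge n$ is *$n$-continuous* if $n=0$, or if $n\ge1$, $i^{-1}(\mathcal O_L)=\mathcal O_F$, and the induced embedding $\overline i:\overline F\to\overline L$ is $(n-1)$-continuous. A *regular $n$-chain* $\underline A=(A,\mathfrak p_n,\dots,\mathfrak p_0)$ is a Noetherian regular local ring $A$ of dimension $n$ with a complete flag of prime ideals $\mathfrak p_n\supsetneq\dots\supsetneq\mathfrak p_0$ such that every $A/\mathfrak p_i$ is a regular local ring. A morphism $(A,\mathfrak p_n,\dots,\mathfrak p_0)\to(B,\mathfrak q_n,\dots,\mathfrak q_0)$ of regular $n$-chains is a ring homomorphism $f:A\to B$ with $f^{-1}(\mathfrak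 q_i)=\mathfrak p_i$ for $i=0,\dots,n$. Put $\operatorname{comp}\underline A=(\hat A,\mathfrak p_n\hat A,\dots,\mathfrak p_0\hat A)$, where $\hat A$ is the $\mathfrak p_n$-adic completion of $A$, and, for $n\ge1$, $\operatorname{loc}\underline A=(A_{\mathfrak p_{n-1}},\mathfrak p_{n-1}A_{\mathfrak p_{n-1}},\dots,\mathfrak p_0A_{\mathfrak p_{n-1}})$. Let $HL(\underline A)$ be the ring obtained from $\underline A$ by applying $\operatorname{loc}\operatorname{comp}$ exactly $n$ times. For a morphism $f$ of regular $n$-chains, $HL(f)$ is the ring homomorphism obtained by passing $n$ times to the induced homomorphism of completions and then of localisations. **Theorem.** Let $n\ge0$. Then $HL$ is a functor from the category of regular $n$-chains to the category of fields of $\operatorname{cdvdim}\ge n$ with $n$-continuous embeddings as morphisms. That is: for every regular $n$-chain $\underline A$ the ring $HL(\underline A)$ is a field of $\operatorname{cdvdim}\ge n$; for every morphism $f:\underline A\to\underline B$ of regular $n$-chains the homomorphism $HL(f):HL(\underline A)\to HL(\underline B)$ is well defined (at each step the induced homomorphism pulls back the flag of the target to the flag of the source) and is an $n$-continuous embedding;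 and $HL$ respects identities and composition. -/

import Mathlib

open CategoryTheory
open scoped WithZero

universe u

/-! ### Complete discrete valuation fields -/

/-- A (surjective) discrete valuation on `F`, written multiplicatively (`ℤᵐ⁰` is `ℤ` with `∞` added,
order reversed), such that `F` is complete in the valuation topology. -/
def IsCompleteDiscrete {F : Type u} [Field F] (v : Valuation F ℤᵐ⁰) : Prop :=
  Function.Surjective v ∧ @CompleteSpace F (Valued.mk' v).toUniformSpace

/-- `F` is a complete discrete valuation field: there is a discrete valuation on `F` under which
`F` is complete. This is a property of the bare field `F`. -/
def IsCDVField (F : Type u) [Field F] : Prop :=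
  ∃ v : Valuation F ℤᵐ⁰, IsCompleteDiscrete v

/-- The discrete valuation of a complete discrete valuation field (it is unique). -/
noncomputable def cdvValuation (F : Type u) [Field F] (hF : IsCDVField F) : Valuation F ℤᵐ⁰ :=
  Classical.choose hF

/-- The ring of integers `𝒪_F` of a complete discrete valuation field. -/
noncomputable def cdvIntegers (F : Type u) [Field F] (hF : IsCDVField F) : ValuationSubring F :=
  (cdvValuation F hF).valuationSubring

/-- The residue field of a complete discrete valuation field. -/
abbrev CdvResidue (F : Type u) [Field F] (hF : IsCDVField F) : Type u :=
  IsLocalRing.ResidueField (cdvIntegers F hF)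

/-- One can pass at least `n` times to the residue field, starting with `F`: the fields
`F = F⁽⁰⁾, F⁽¹⁾, …, F⁽ⁿ⁻¹⁾` are complete discrete valuation fields. -/
def HasResidueTower : ℕ → ∀ (F : Type u) [Field F], Prop
  | 0, _, _ => True
  | n + 1, F, _ => ∃ hF : IsCDVField F, HasResidueTower n (CdvResidue F hF)

/-- The complete discrete valuation dimension of a field: the number of times one can pass to the
residue field before reaching a field that is not a complete discrete valuation field, and `⊤` if
this never happens. -/
noncomputable def cdvdim (F : Type u) [Field F] : ℕ∞ :=
  ⨆ (n : ℕ) (_ : HasResidueTower n F), (n : ℕ∞)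

theorem HasResidueTower.of_succ : ∀ (n : ℕ) (F : Type u) [Field F],
    HasResidueTower (n + 1) F → HasResidueTower n F
  | 0, _, _, _ => trivial
  | n + 1, _, _, ⟨hF, h⟩ => ⟨hF, HasResidueTower.of_succ n _ h⟩

theorem HasResidueTower.mono {m n : ℕ} (hmn : m ≤ n) {F : Type u} [Field F]
    (h : HasResidueTower n F) : HasResidueTower m F := by
  induction hmn with
  | refl => exact h
  | step _ ih => exact ih (HasResidueTower.of_succ _ F h)

theorem le_cdvdim_iff (n : ℕ) (F : Type u) [Field F] :
    (n : ℕ∞) ≤ cdvdim F ↔ HasResidueTower n F := by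
  refine ⟨fun h => ?_, fun h => le_iSup₂_of_le n h le_rfl⟩
  cases n with
  | zero => trivial
  | succ n =>
    by_contra hn
    have hle : cdvdim F ≤ (n : ℕ∞) := by
      refine iSup₂_le fun m hm => ?_
      by_contra hmn
      have : n + 1 ≤ m := by
        have h' : n < m := by exact_mod_cast not_le.mp hmn
        exact h'
      exact hn (hm.mono this)
    have : ((n + 1 : ℕ) : ℕ∞) ≤ (n : ℕ∞) := h.trans hle
    have : n + 1 ≤ n := by exact_mod_cast this
    omega

/-- The recursive description of `cdvdim`, first half. -/
theorem cdvdim_eq_zero (F : Type u) [Field F] (hF : ¬ IsCDVField F) : cdvdim F = 0 := by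
  by_contra h
  have h1 : ((1 : ℕ) : ℕ∞) ≤ cdvdim F := by
    simpa using Order.one_le_iff_ne_zero.mpr h
  exact hF ((le_cdvdim_iff 1 F).mp h1).1

/-- The recursive description of `cdvdim`, second half. -/
theorem cdvdim_eq_add_one (F : Type u) [Field F] (hF : IsCDVField F) :
    cdvdim F = cdvdim (CdvResidue F hF) + 1 := by
  refine ENat.eq_of_forall_natCast_le_iff fun m => ?_
  cases m with
  | zero => simp
  | succ m =>
    rw [Nat.cast_add, Nat.cast_one, ENat.add_le_add_iff_right (by simp), le_cdvdim_iff,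
      ← Nat.cast_one, ← Nat.cast_add, le_cdvdim_iff]
    exact ⟨fun h => h.2, fun h => ⟨hF, h⟩⟩

/-! ### `n`-continuous embeddings -/

/-- `i : F → L` is a morphism of complete discrete valuation fields: `i⁻¹(𝒪_L) = 𝒪_F`. -/
def IsCDVMorphism {F L : Type u} [Field F] [Field L] (hF : IsCDVField F) (hL : IsCDVField L)
    (i : F →+* L) : Prop :=
  (cdvIntegers L hL).comap i = cdvIntegers F hF

/-- The homomorphism `𝒪_F → 𝒪_L` induced by a morphism of complete discrete valuation fields. -/
noncomputable def cdvIntegersMap {F L : Type u} [Field F] [Field L] {hF : IsCDVField F} {hL : IsCDVField L}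
    (i : F →+* L) (hi : IsCDVMorphism hF hL i) : cdvIntegers F hF →+* cdvIntegers L hL :=
  (i.comp (cdvIntegers F hF).subtype).codRestrict (cdvIntegers L hL).toSubring fun x => by
    have hx : (x : F) ∈ (cdvIntegers L hL).comap i := by
      rw [show (cdvIntegers L hL).comap i = cdvIntegers F hF from hi]
      exact x.2
    exact hx

theorem isLocalHom_cdvIntegersMap {F L : Type u} [Field F] [Field L] {hF : IsCDVField F}
    {hL : IsCDVField L} (i : F →+* L) (hi : IsCDVMorphism hF hL i) :
    IsLocalHom (cdvIntegersMap i hi) := by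
  refine ⟨fun x hx => ?_⟩
  obtain ⟨y, hy⟩ := hx.exists_right_inv
  have hy' : i (x : F) * (y : L) = 1 := congrArg Subtype.val hy
  have hx0 : (x : F) ≠ 0 := by
    intro h0
    rw [h0] at hy'
    simp at hy'
  have hyi : i ((x : F)⁻¹) = (y : L) := by
    rw [map_inv₀]
    exact inv_eq_of_mul_eq_one_right hy'
  have hmem : ((x : F)⁻¹) ∈ cdvIntegers F hF := by
    have h : (x : F)⁻¹ ∈ (cdvIntegers L hL).comap i := by
      rw [ValuationSubring.mem_comap, hyi]
      exact y.2
    exact (show (cdvIntegers L hL).comap i = cdvIntegers F hF from hi).le h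
  exact IsUnit.of_mul_eq_one ⟨(x : F)⁻¹, hmem⟩ (Subtype.ext (mul_inv_cancel₀ hx0))

/-- The embedding of residue fields induced by a morphism of complete discrete valuation fields. -/
noncomputable def cdvResidueMap {F L : Type u} [Field F] [Field L] {hF : IsCDVField F}
    {hL : IsCDVField L} (i : F →+* L) (hi : IsCDVMorphism hF hL i) :
    CdvResidue F hF →+* CdvResidue L hL :=
  haveI := isLocalHom_cdvIntegersMap i hi
  IsLocalRing.ResidueField.map (cdvIntegersMap i hi)

/-- `n`-continuity of a field embedding: every embedding is `0`-continuous, and an embedding is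
`(n+1)`-continuous if it is a morphism of complete discrete valuation fields and the induced
embedding of residue fields is `n`-continuous. -/
def IsNContinuous : ℕ → ∀ {F L : Type u} [Field F] [Field L], (F →+* L) → Prop
  | 0, _, _, _, _, _ => True
  | n + 1, F, L, _, _, i => ∃ (hF : IsCDVField F) (hL : IsCDVField L) (hi : IsCDVMorphism hF hL i),
      IsNContinuous n (cdvResidueMap i hi)

theorem IsNContinuous.id : ∀ (n : ℕ) (F : Type u) [Field F], HasResidueTower n F →
    IsNContinuous n (RingHom.id F)
  | 0, _, _, _ => trivial
  | n + 1, F, _, ⟨hF, h⟩ => by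
    have hi : IsCDVMorphism hF hF (RingHom.id F) := rfl
    refine ⟨hF, hF, hi, ?_⟩
    have : cdvResidueMap (RingHom.id F) hi = RingHom.id (CdvResidue F hF) := by
      refine RingHom.ext fun y => ?_
      obtain ⟨x, rfl⟩ := IsLocalRing.residue_surjective y
      rfl
    rw [this]
    exact IsNContinuous.id n _ h

theorem IsNContinuous.comp : ∀ (n : ℕ) {F K L : Type u} [Field F] [Field K] [Field L]
    {i : F →+* K} {j : K →+* L}, IsNContinuous n i → IsNContinuous n j →
    IsNContinuous n (j.comp i)
  | 0, _, _, _, _, _, _, _, _, _, _ => trivial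
  | n + 1, F, K, L, _, _, _, i, j, ⟨hF, hK, hi, h⟩, ⟨_, hL, hj, h'⟩ => by
    have hji : IsCDVMorphism hF hL (j.comp i) := by
      unfold IsCDVMorphism at hi hj ⊢
      rw [← ValuationSubring.comap_comap, hj, hi]
    refine ⟨hF, hL, hji, ?_⟩
    have : cdvResidueMap (j.comp i) hji = (cdvResidueMap j hj).comp (cdvResidueMap i hi) := by
      refine RingHom.ext fun y => ?_
      obtain ⟨x, rfl⟩ := IsLocalRing.residue_surjective y
      rfl
    rw [this]
    exact IsNContinuous.comp n h h'

/-- The objects of the category of fields of `cdvdim ≥ n`. -/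
structure CdvFieldCat (n : ℕ) : Type (u + 1) where
  carrier : Type u
  [field : Field carrier]
  le_cdvdim : (n : ℕ∞) ≤ cdvdim carrier

namespace CdvFieldCat

attribute [instance] CdvFieldCat.field

variable {n : ℕ}

/-- The morphisms between fields of `cdvdim ≥ n` are the `n`-continuous embeddings. -/
@[ext]
structure Hom (F L : CdvFieldCat.{u} n) : Type u where
  hom : F.carrier →+* L.carrier
  nContinuous : IsNContinuous n hom

instance : Category (CdvFieldCat.{u} n) where
  Hom F L := Hom F L
  id F := ⟨RingHom.id _, IsNContinuous.id n _ ((le_cdvdim_iff n _).mp F.le_cdvdim)⟩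
  comp f g := ⟨g.hom.comp f.hom, IsNContinuous.comp n f.nContinuous g.nContinuous⟩

end CdvFieldCat

/-! ### Flags of ideals, completion and localisation -/

/-- A commutative ring together with ideals `𝔭₀, …, 𝔭ₙ`. -/
structure FlaggedRing (n : ℕ) : Type (u + 1) where
  carrier : Type u
  [commRing : CommRing carrier]
  ideal : Fin (n + 1) → Ideal carrier

namespace FlaggedRing

attribute [instance] FlaggedRing.commRing

/-- Regular `n`-chains: `A` is a (Noetherian) regular local ring of dimension `n` and
`𝔭₀ ⊂ 𝔭₁ ⊂ ⋯ ⊂ 𝔭ₙ` is a complete flag of primes for which every `A ⧸ 𝔭ᵢ` is regular. -/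
structure IsRegularChain {n : ℕ} (A : FlaggedRing.{u} n) : Prop where
  isRegularLocalRing : IsRegularLocalRing A.carrier
  ringKrullDim_eq : ringKrullDim A.carrier = n
  isPrime : ∀ i, (A.ideal i).IsPrime
  strictMono : StrictMono A.ideal
  isRegularLocalRing_quotient : ∀ i, IsRegularLocalRing (A.carrier ⧸ A.ideal i)

/-- The ring homomorphism `f : A → B` pulls back the flag of `B` to the flag of `A`. -/
def PullsBack {n : ℕ} {A B : FlaggedRing.{u} n} (f : A.carrier →+* B.carrier) : Prop :=
  ∀ i, (B.ideal i).comap f = A.ideal i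

/-- `comp A = (Â, 𝔭ₙÂ, …, 𝔭₀Â)`, where `Â` is the `𝔭ₙ`-adic completion of `A`. -/
noncomputable def comp {n : ℕ} (A : FlaggedRing.{u} n) : FlaggedRing.{u} n where
  carrier := AdicCompletion (A.ideal (Fin.last n)) A.carrier
  ideal i := (A.ideal i).map
    (algebraMap A.carrier (AdicCompletion (A.ideal (Fin.last n)) A.carrier))

/-- The multiplicative set generated by the complement of `𝔭ₙ₋₁`. -/
def locSubmonoid {n : ℕ} (A : FlaggedRing.{u} (n + 1)) : Submonoid A.carrier :=
  Submonoid.closure ((A.ideal (Fin.last n).castSucc : Set A.carrier)ᶜ)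

/-- If `𝔭ₙ₋₁` is prime, then `locSubmonoid` is just its complement. -/
theorem locSubmonoid_eq {n : ℕ} (A : FlaggedRing.{u} (n + 1))
    [h : (A.ideal (Fin.last n).castSucc).IsPrime] :
    A.locSubmonoid = (A.ideal (Fin.last n).castSucc).primeCompl :=
  Submonoid.closure_eq (A.ideal (Fin.last n).castSucc).primeCompl

/-- `loc A = (S, 𝔭ₙ₋₁S, …, 𝔭₀S)`, where `S` is the localisation of `A` at `𝔭ₙ₋₁`. -/
noncomputable def loc {n : ℕ} (A : FlaggedRing.{u} (n + 1)) : FlaggedRing.{u} n where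
  carrier := Localization A.locSubmonoid
  ideal i := (A.ideal i.castSucc).map (algebraMap A.carrier (Localization A.locSubmonoid))

/-- `HL A = loc comp ⋯ loc comp A` (`n` times), as a flag of length `0`. -/
noncomputable def HL : ∀ {n : ℕ}, FlaggedRing.{u} n → FlaggedRing.{u} 0
  | 0, A => A
  | _ + 1, A => HL A.comp.loc

theorem PullsBack.pow_le {n : ℕ} {A B : FlaggedRing.{u} n} {f : A.carrier →+* B.carrier}
    (hf : PullsBack f) (i : Fin (n + 1)) (k : ℕ) :
    A.ideal i ^ k ≤ (B.ideal i ^ k).comap f := by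
  rw [← hf i]
  exact Ideal.le_comap_pow f k

/-- The homomorphism `Â → B̂` induced by `f : A → B`: the inverse limit of the homomorphisms
`A ⧸ 𝔭ₙᵏ → B ⧸ 𝔮ₙᵏ`. -/
noncomputable def compMap {n : ℕ} {A B : FlaggedRing.{u} n} (f : A.carrier →+* B.carrier)
    (hf : PullsBack f) : A.comp.carrier →+* B.comp.carrier :=
  AdicCompletion.liftRingHom (B.ideal (Fin.last n))
    (fun k => (Ideal.quotientMap (B.ideal (Fin.last n) ^ k) f (hf.pow_le (Fin.last n) k)).comp
      (AdicCompletion.evalₐ (A.ideal (Fin.last n)) k).toRingHom)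
    (by
      intro k l hkl
      refine RingHom.ext fun x => ?_
      obtain ⟨a, rfl⟩ := AdicCompletion.mk_surjective _ _ x
      have h2 := Ideal.Quotient.eq.mp
        (AdicCompletion.Ideal.mk_eq_mk (A.ideal (Fin.last n)) hkl a)
      change Ideal.Quotient.factorPow _ hkl (Ideal.quotientMap _ f (hf.pow_le (Fin.last n) l)
        (AdicCompletion.evalₐ _ l (AdicCompletion.mk _ _ a))) =
        Ideal.quotientMap _ f (hf.pow_le (Fin.last n) k)
          (AdicCompletion.evalₐ _ k (AdicCompletion.mk _ _ a))
      rw [AdicCompletion.evalₐ_mk, AdicCompletion.evalₐ_mk, Ideal.quotientMap_mk,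
        Ideal.quotientMap_mk]
      refine Ideal.Quotient.eq.mpr ?_
      rw [← map_sub]
      exact hf.pow_le (Fin.last n) k h2)

/-- The homomorphism `A_{𝔭ₙ₋₁} → B_{𝔮ₙ₋₁}` of localisations induced by `f : A → B`. -/
noncomputable def locMap {n : ℕ} {A B : FlaggedRing.{u} (n + 1)} (f : A.carrier →+* B.carrier)
    (hf : PullsBack f) : A.loc.carrier →+* B.loc.carrier :=
  IsLocalization.map (S := Localization A.locSubmonoid) (M := A.locSubmonoid) (T := B.locSubmonoid)
    (Localization B.locSubmonoid) f
    (by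
      refine Submonoid.closure_le.mpr fun x hx => Submonoid.subset_closure fun hx' => hx ?_
      rw [SetLike.mem_coe, ← hf (Fin.last n).castSucc]
      exact hx')

/-- `g : HL A → HL B` is the homomorphism `HL f` obtained from `f : A → B` by applying
`loc comp` to `f` exactly `n` times; in particular, at every step the homomorphism pulls back the
flags, so that the next one is defined. -/
def IsHLMap : ∀ {n : ℕ} {A B : FlaggedRing.{u} n}, (A.carrier →+* B.carrier) →
    (A.HL.carrier →+* B.HL.carrier) → Prop
  | 0, _, _, f, g => g = f
  | _ + 1, A, B, f, g => ∃ (hf : PullsBack f) (hc : PullsBack (A := A.comp) (B := B.comp)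
      (compMap f hf)), IsHLMap (A := A.comp.loc) (B := B.comp.loc)
        (locMap (A := A.comp) (B := B.comp) (compMap f hf) hc) g

end FlaggedRing

/-- The objects of the category of regular `n`-chains. -/
structure RegularChainCat (n : ℕ) : Type (u + 1) where
  toFlaggedRing : FlaggedRing.{u} n
  isRegularChain : toFlaggedRing.IsRegularChain

namespace RegularChainCat

variable {n : ℕ}

/-- A morphism `(A, 𝔭ₙ, …, 𝔭₀) → (B, 𝔮ₙ, …, 𝔮₀)` of regular `n`-chains is a ring homomorphism
`f : A → B` with `f⁻¹(𝔮ᵢ) = 𝔭ᵢ` for all `i`. -/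
@[ext]
structure Hom (A B : RegularChainCat.{u} n) : Type u where
  hom : A.toFlaggedRing.carrier →+* B.toFlaggedRing.carrier
  pullsBack : FlaggedRing.PullsBack hom

instance : Category (RegularChainCat.{u} n) where
  Hom A B := Hom A B
  id A := ⟨RingHom.id _, fun i => Ideal.comap_id _⟩
  comp f g := ⟨g.hom.comp f.hom, fun i => by
    rw [← Ideal.comap_comap, g.pullsBack i, f.pullsBack i]⟩

end RegularChainCat

/-! ### Regular local rings -/

section RegularLocalRing

open IsLocalRing

variable {R : Type*} [CommRing R]

/-! Regularity is used only once. A regular local ring is a domain, and a prime with regular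
quotient of dimension one less is principal; hence in a regular chain each prime is generated by the
previous one and one more element. This weaker structure, `IsPrincipalChain`, is stable under
`comp`, `loc` and division by `𝔭₁`, so regularity need not be tracked through the construction.

For the completion, go down the flag: `Â/𝔭ᵢÂ` is the completion of `A/𝔭ᵢ`, and the next generator
`x` is a nonzerodivisor in it by flatness. Modulo `x` it is a Noetherian domain by induction, and
completeness lifts both properties (`isNoetherianRing_of_isAdicComplete`,
`isDomain_of_isHausdorff`). The same descent with Nakayama's lemma shows that the completed
homomorphism pulls the flag back to the flag (`PullsBack.compMap`). After `n` steps the chain has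
length zero, so its maximal ideal vanishes and `HL A` is a field.

For the discrete valuation, compare `A` with `C = A/𝔭₁`. Completion and localisation commute with
this quotient until `A` has length one and `C` length zero. One last completion turns `A` into a
complete discrete valuation ring with residue field `HL C`, and the last localisation is its field
of fractions `HL A` (`IsHLMap.exists_discretePlace`). This is natural in `A`, so `n`-continuity
follows by induction on `n` through `C`; the bound on `cdvdim` is then read off from `n`-continuity
of the identity.

The ring of integers in the definition comes from an arbitrarily chosen valuation. By Hensel's
lemma, every surjective discrete valuation on the fraction field of a complete discrete valuation
ring `D` has valuation ring `D` (`valuation_le_one_iff_mem_range`), so the choice is harmless. -/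

theorem isLocalRing_quotient [IsLocalRing R] {I : Ideal R} (hI : I ≠ ⊤) : IsLocalRing (R ⧸ I) := by
  have := Ideal.Quotient.nontrivial_iff.mpr hI
  exact .of_surjective' _ Ideal.Quotient.mk_surjective

variable [IsLocalRing R] [IsNoetherianRing R]

/-- The class of `x` in `𝔪/𝔪²` is nonzero, so it extends to a basis. By Nakayama, `x` and lifts of
the other basis vectors generate `𝔪`, and modulo `x` one generator disappears. -/
theorem spanFinrank_maximalIdeal_quotient_span_singleton {x : R} [IsLocalRing (R ⧸ Ideal.span {x})]
    (hx : x ∈ maximalIdeal R) (hx2 : x ∉ maximalIdeal R ^ 2) :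
    (maximalIdeal (R ⧸ Ideal.span {x})).spanFinrank + 1 ≤ (maximalIdeal R).spanFinrank := by
  classical
  set v := (maximalIdeal R).toCotangent ⟨x, hx⟩ with hv
  have hv0 : v ≠ 0 := fun h => hx2 ((Ideal.toCotangent_eq_zero _ _).mp h)
  have hli : LinearIndepOn (ResidueField R) id ({v} : Set (CotangentSpace R)) :=
    LinearIndepOn.singleton hv0
  set b := hli.extend (Set.subset_univ _) with hb
  let B : Module.Basis b (ResidueField R) (CotangentSpace R) := Module.Basis.extend hli
  have hvb : v ∈ b := hli.subset_extend _ rfl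
  have hbfin : b.Finite := Module.Finite.finite_basis B
  have hcard : b.ncard = (maximalIdeal R).spanFinrank := by
    rw [spanFinrank_maximalIdeal_eq_finrank_cotangentSpace, Module.finrank_eq_nat_card_basis B]
    rfl
  let l := Function.surjInv (maximalIdeal R).toCotangent_surjective
  have hl : ∀ w, (maximalIdeal R).toCotangent (l w) = w := Function.surjInv_eq _
  have hspan : Submodule.span R (insert ⟨x, hx⟩ (l '' (b \ {v}))) = ⊤ := by
    rw [← CotangentSpace.span_image_eq_top_iff, ← top_le_iff, ← B.span_eq]
    refine Submodule.span_mono ?_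
    rintro _ ⟨⟨w, hw⟩, rfl⟩
    have hBw : B ⟨w, hw⟩ = w := Module.Basis.extend_apply_self hli _
    rw [hBw]
    by_cases h : w = v
    · exact ⟨_, Set.mem_insert _ _, h.symm⟩
    · exact ⟨l w, Set.mem_insert_of_mem _ ⟨w, ⟨hw, h⟩, rfl⟩, hl w⟩
  have hspan' : Ideal.span (insert x ((fun w => (l w : R)) '' (b \ {v}))) = maximalIdeal R := by
    have := congrArg (Submodule.map (maximalIdeal R).subtype) hspan
    rw [Submodule.map_span, Set.image_insert_eq, Set.image_image, Submodule.map_top,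
      Submodule.range_subtype] at this
    exact this
  have hmax : maximalIdeal (R ⧸ Ideal.span {x}) =
      Ideal.span ((fun w => Ideal.Quotient.mk (Ideal.span {x}) (l w)) '' (b \ {v})) := by
    have := congrArg (Ideal.map (Ideal.Quotient.mk (Ideal.span {x}))) hspan'
    rw [map_maximalIdeal_of_surjective _ Ideal.Quotient.mk_surjective, Ideal.map_span,
      Set.image_insert_eq, Set.image_image,
      Ideal.Quotient.eq_zero_iff_mem.mpr (Ideal.mem_span_singleton_self x),
      Ideal.span_insert_zero] at this
    exact this.symm
  have h1 : (b \ {v}).ncard + 1 = b.ncard := Set.ncard_sdiff_singleton_add_one hvb hbfin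
  rw [← hcard, ← h1, hmax]
  have hfin : (b \ {v}).Finite := hbfin.sdiff
  exact Nat.add_le_add_right ((Submodule.spanFinrank_span_le_ncard_of_finite (hfin.image _)).trans
    (Set.ncard_image_le hfin)) 1

theorem le_ringKrullDim_quotient_span_singleton {x : R} {d : ℕ} (hx : x ∈ maximalIdeal R)
    (hd : ((d + 1 : ℕ) : WithBot ℕ∞) ≤ ringKrullDim R) :
    (d : WithBot ℕ∞) ≤ ringKrullDim (R ⧸ Ideal.span {x}) := by
  rw [← maximalIdeal_height_eq_ringKrullDim] at hd
  have := hd.trans (Ideal.height_le_ringKrullDim_quotient_add_one hx)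
  rw [Nat.cast_add, Nat.cast_one] at this
  generalize ringKrullDim (R ⧸ Ideal.span {x}) = r at this
  induction r using WithBot.recBotCoe with
  | bot => exact absurd (le_bot_iff.mp this) (by exact_mod_cast WithBot.coe_ne_bot)
  | coe r =>
    have h : (d : ℕ∞) + 1 ≤ r + 1 := by exact_mod_cast this
    exact_mod_cast (ENat.add_le_add_iff_right (by simp)).mp h

/-- Regular local rings are domains; regularity is split into two inequalities so that it passes to
`R/(x)` without computing the dimension exactly. Take `x ∈ 𝔪` outside `𝔪²` and all minimal primes.
By induction `(x)` is prime, so it contains a minimal prime `q`; as `x ∉ q`, `q = xq`, and Nakayama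
gives `q = 0`. -/
theorem isDomain_of_spanFinrank_le : ∀ (d : ℕ) {R : Type*} [CommRing R] [IsLocalRing R]
    [IsNoetherianRing R], (maximalIdeal R).spanFinrank ≤ d →
    (d : WithBot ℕ∞) ≤ ringKrullDim R → IsDomain R
  | 0, R, _, _, _, h, _ => by
    have h0 := (Submodule.spanFinrank_eq_zero_iff_eq_bot
      (IsNoetherian.noetherian (maximalIdeal R))).mp (Nat.le_zero.mp h)
    exact (isField_iff_maximalIdeal_eq.mpr h0).isDomain
  | d + 1, R, _, _, _, h, hd => by
    classical
    have hjac : maximalIdeal R ≤ (⊥ : Ideal R).jacobson := maximalIdeal_le_jacobson _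
    have hnm : ∀ q ∈ minimalPrimes R, ¬ maximalIdeal R ≤ q := by
      intro q hq hle
      have hp : q.IsPrime := hq.1.1
      have hqm : maximalIdeal R = q := le_antisymm hle (le_maximalIdeal hp.ne_top)
      have h0 := Ideal.height_le_spanRank_toENat_of_mem_minimalPrimes (⊥ : Ideal R) q hq
      rw [Submodule.spanRank_bot, map_zero, ← hqm] at h0
      rw [← maximalIdeal_height_eq_ringKrullDim] at hd
      have h1 : ((d + 1 : ℕ) : ℕ∞) ≤ 0 := le_trans (by exact_mod_cast hd) h0
      simp at h1
    have hx : ∃ x ∈ maximalIdeal R, x ∉ maximalIdeal R ^ 2 ∧ ∀ q ∈ minimalPrimes R, x ∉ q := by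
      by_contra! hcon
      have hfin := minimalPrimes.finite_of_isNoetherianRing R
      -- Prime avoidance tolerates two ideals that are not prime; `𝔪²` fills both exceptional slots.
      have := (Ideal.subset_union_prime (s := insert (maximalIdeal R ^ 2) hfin.toFinset) (f := id)
        (maximalIdeal R ^ 2) (maximalIdeal R ^ 2) (fun q hq h1 _ => by
          have hq' : q ∈ minimalPrimes R := by simpa [h1] using hq
          exact hq'.1.1) (I := maximalIdeal R)).mp (by
        intro x hx
        by_cases hx2 : x ∈ maximalIdeal R ^ 2
        · exact Set.mem_biUnion (Finset.mem_coe.mpr (Finset.mem_insert_self _ _)) hx2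
        · obtain ⟨q, hq, hxq⟩ := hcon x hx hx2
          exact Set.mem_biUnion (Finset.mem_coe.mpr
            (Finset.mem_insert_of_mem (hfin.mem_toFinset.mpr hq))) hxq)
      obtain ⟨q, hq, hle⟩ := this
      rcases Finset.mem_insert.mp hq with rfl | hq
      · have hbot : maximalIdeal R = ⊥ :=
          Submodule.eq_bot_of_le_smul_of_le_jacobson_bot (maximalIdeal R) _
            (IsNoetherian.noetherian _) (by simpa [sq] using hle) hjac
        obtain ⟨q, hq, -⟩ := Ideal.exists_minimalPrimes_le (I := (⊥ : Ideal R))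
          (bot_le : ⊥ ≤ maximalIdeal R)
        exact hnm q hq (hbot ▸ bot_le)
      · exact hnm q (hfin.mem_toFinset.mp hq) hle
    obtain ⟨x, hxm, hx2, hxq⟩ := hx
    have hloc : IsLocalRing (R ⧸ Ideal.span {x}) := isLocalRing_quotient
      fun h => (maximalIdeal.isMaximal R).ne_top
        (top_le_iff.mp (h ▸ (Ideal.span_singleton_le_iff_mem _).mpr hxm))
    have hdom : IsDomain (R ⧸ Ideal.span {x}) := isDomain_of_spanFinrank_le d
      (by have := spanFinrank_maximalIdeal_quotient_span_singleton hxm hx2; omega)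
      (le_ringKrullDim_quotient_span_singleton hxm hd)
    have hprime : (Ideal.span {x}).IsPrime := (Ideal.Quotient.isDomain_iff_prime _).mp hdom
    obtain ⟨q, hq, hqx⟩ := Ideal.exists_minimalPrimes_le (I := (⊥ : Ideal R))
      (bot_le : ⊥ ≤ Ideal.span {x})
    have hqp : q.IsPrime := hq.1.1
    have hq0 : q = ⊥ := by
      refine Submodule.eq_bot_of_le_smul_of_le_jacobson_bot (maximalIdeal R) _
        (IsNoetherian.noetherian _) (fun y hy => ?_) hjac
      obtain ⟨z, rfl⟩ := Ideal.mem_span_singleton'.mp (hqx hy)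
      have hz : z ∈ q := (hqp.mem_or_mem hy).resolve_right (hxq q hq)
      rw [mul_comm]
      exact Submodule.smul_mem_smul hxm hz
    rw [hq0] at hqp
    exact IsDomain.of_bot_isPrime R

theorem ringKrullDim_quotient_add_one_le {R : Type*} [CommRing R] [IsDomain R] {I : Ideal R}
    (hI : I ≠ ⊥) : ringKrullDim (R ⧸ I) + 1 ≤ ringKrullDim R := by
  obtain ⟨y, hy, hy0⟩ := Submodule.exists_mem_ne_zero_of_ne_bot hI
  refine le_trans ?_ (ringKrullDim_quotient_succ_le_of_nonZeroDivisor
    (mem_nonZeroDivisors_of_ne_zero hy0))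
  gcongr
  exact ringKrullDim_le_of_surjective (Ideal.Quotient.factor
    ((Ideal.span_singleton_le_iff_mem I).mpr hy)) (Ideal.Quotient.factor_surjective _)

/-- Any `x ∈ P` outside `𝔪²` generates `P`: `R/(x)` is a domain of dimension at most `d`, so its
quotient `R/P`, of dimension at least `d`, cannot be proper. -/
theorem exists_eq_span_singleton_of_isRegularLocalRing_quotient {d : ℕ} {P : Ideal R} [P.IsPrime]
    [IsLocalRing (R ⧸ P)] (h : (maximalIdeal R).spanFinrank ≤ d + 1)
    (hd : ((d + 1 : ℕ) : WithBot ℕ∞) ≤ ringKrullDim R)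
    (hP : (maximalIdeal (R ⧸ P)).spanFinrank ≤ d) (hPd : (d : WithBot ℕ∞) ≤ ringKrullDim (R ⧸ P)) :
    ∃ x, P = Ideal.span {x} := by
  have hPm : P ≤ maximalIdeal R := le_maximalIdeal (Ideal.IsPrime.ne_top ‹_›)
  have hjac : maximalIdeal R ≤ (⊥ : Ideal R).jacobson := maximalIdeal_le_jacobson _
  obtain ⟨x, hxP, hx2⟩ : ∃ x ∈ P, x ∉ maximalIdeal R ^ 2 := by
    -- If `P ⊆ 𝔪²`, lifts of generators of the maximal ideal of `R/P` generate `𝔪` modulo `𝔪²`,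
    -- hence generate `𝔪`. Then `d` elements suffice, against dimension at least `d + 1`.
    by_contra! hcon
    obtain ⟨s, hs, hspan⟩ := Submodule.FG.exists_span_finset_card_eq_spanFinrank
      (IsNoetherian.noetherian (maximalIdeal (R ⧸ P)))
    classical
    obtain ⟨l, hl⟩ := (Ideal.Quotient.mk_surjective (I := P)).hasRightInverse
    have hmap : (Ideal.span ((s.image l : Finset R) : Set R)).map (Ideal.Quotient.mk P) =
        maximalIdeal (R ⧸ P) := by
      rw [Ideal.map_span, Finset.coe_image, Set.image_image]
      simpa only [hl _, Set.image_id'] using hspan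
    have hle' : Ideal.span ((s.image l : Finset R) : Set R) ≤ maximalIdeal R := by
      refine le_maximalIdeal fun htop => (maximalIdeal.isMaximal (R ⧸ P)).ne_top ?_
      rw [← hmap, htop, Ideal.map_top]
    have hle : maximalIdeal R ≤ Ideal.span ((s.image l : Finset R) : Set R) := by
      refine Submodule.le_of_le_smul_of_le_jacobson_bot (IsNoetherian.noetherian _) hjac
        fun y hy => ?_
      have h1 : Ideal.Quotient.mk P y ∈
          (Ideal.span ((s.image l : Finset R) : Set R)).map (Ideal.Quotient.mk P) := by
        rw [hmap, ← map_maximalIdeal_of_surjective _ Ideal.Quotient.mk_surjective]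
        exact Ideal.mem_map_of_mem _ hy
      obtain ⟨z, hz, hzy⟩ := (Ideal.mem_map_iff_of_surjective _ Ideal.Quotient.mk_surjective).mp h1
      refine Submodule.mem_sup.mpr ⟨z, hz, y - z, ?_, by ring⟩
      simpa [sq] using hcon _ (Ideal.Quotient.eq.mp hzy.symm)
    have h2 := (congrArg Submodule.spanFinrank (le_antisymm hle hle')).trans_le
      (Submodule.spanFinrank_span_le_ncard_of_finite (Finset.finite_toSet _))
    rw [Set.ncard_coe_finset] at h2
    have h3 := h2.trans Finset.card_image_le
    have h4 := hd.trans (ringKrullDim_le_spanFinrank_maximalIdeal R)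
    have h5 : d + 1 ≤ (maximalIdeal R).spanFinrank := by exact_mod_cast h4
    omega
  have hxm := hPm hxP
  have hloc : IsLocalRing (R ⧸ Ideal.span {x}) := isLocalRing_quotient
    fun h => (maximalIdeal.isMaximal R).ne_top
      (top_le_iff.mp (h ▸ (Ideal.span_singleton_le_iff_mem _).mpr hxm))
  have hsp : (maximalIdeal (R ⧸ Ideal.span {x})).spanFinrank ≤ d := by
    have := spanFinrank_maximalIdeal_quotient_span_singleton hxm hx2; omega
  have hdom : IsDomain (R ⧸ Ideal.span {x}) := isDomain_of_spanFinrank_le d hsp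
    (le_ringKrullDim_quotient_span_singleton hxm hd)
  have hxle : Ideal.span {x} ≤ P := (Ideal.span_singleton_le_iff_mem _).mpr hxP
  refine ⟨x, le_antisymm ?_ hxle⟩
  by_contra hne
  have hbot : P.map (Ideal.Quotient.mk (Ideal.span {x})) ≠ ⊥ := by
    rwa [Ne, Ideal.map_eq_bot_iff_le_ker, Ideal.mk_ker]
  have h1 := ringKrullDim_quotient_add_one_le hbot
  rw [ringKrullDim_eq_of_ringEquiv (DoubleQuot.quotQuotEquivQuotOfLE hxle)] at h1
  have h2 := (add_le_add_left hPd 1).trans (h1.trans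
    ((ringKrullDim_le_spanFinrank_maximalIdeal _).trans (Nat.cast_le.mpr hsp)))
  have h3 : d + 1 ≤ d := by exact_mod_cast h2
  omega

end RegularLocalRing

/-! ### Flags whose steps are generated by one element -/

namespace FlaggedRing

open IsLocalRing

/-- A Noetherian local ring with a chain of primes from `⊥` to the maximal ideal in which each
prime is generated by the previous one and one further element. -/
structure IsPrincipalChain {n : ℕ} (A : FlaggedRing.{u} n) : Prop where
  isNoetherianRing : IsNoetherianRing A.carrier
  isLocalRing : IsLocalRing A.carrier
  isMaximal : (A.ideal (Fin.last n)).IsMaximal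
  ideal_zero : A.ideal 0 = ⊥
  isPrime : ∀ i, (A.ideal i).IsPrime
  exists_succ : ∀ i : Fin n, ∃ x ∉ A.ideal i.castSucc,
    A.ideal i.succ = A.ideal i.castSucc ⊔ Ideal.span {x}

namespace IsPrincipalChain

variable {n : ℕ} {A : FlaggedRing.{u} n}

theorem maximalIdeal_eq (hA : A.IsPrincipalChain) [IsLocalRing A.carrier] :
    A.ideal (Fin.last n) = maximalIdeal A.carrier :=
  IsLocalRing.eq_maximalIdeal hA.isMaximal

theorem isDomain (hA : A.IsPrincipalChain) : IsDomain A.carrier := by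
  have := hA.isPrime 0
  rw [hA.ideal_zero] at this
  exact IsDomain.of_bot_isPrime _

theorem monotone (hA : A.IsPrincipalChain) : Monotone A.ideal := by
  refine Fin.monotone_iff_le_succ.mpr fun i => ?_
  obtain ⟨x, -, h⟩ := hA.exists_succ i
  exact h ▸ le_sup_left

end IsPrincipalChain

/-! ### Regular chains are principal chains -/

variable {n : ℕ} {A : FlaggedRing.{u} n}

theorem ringKrullDim_quotient_add_one_le_of_lt {R : Type*} [CommRing R] {p q : Ideal R} [p.IsPrime]
    (h : p < q) : ringKrullDim (R ⧸ q) + 1 ≤ ringKrullDim (R ⧸ p) := by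
  have hbot : q.map (Ideal.Quotient.mk p) ≠ ⊥ := by
    rw [Ne, Ideal.map_eq_bot_iff_le_ker, Ideal.mk_ker]
    exact not_le_of_gt h
  have := ringKrullDim_quotient_add_one_le hbot
  rwa [ringKrullDim_eq_of_ringEquiv (DoubleQuot.quotQuotEquivQuotOfLE h.le)] at this

namespace IsRegularChain

/-- The dimension of `A/𝔭ᵢ` drops by at least one at each of the `n` steps, starts at most at `n`
and stays nonnegative, so each drop is exactly one. -/
theorem ringKrullDim_quotient_eq (hA : A.IsRegularChain) (i : Fin (n + 1)) :
    ∃ r : ℕ, r + i = n ∧ ringKrullDim (A.carrier ⧸ A.ideal i) = r := by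
  have hreg := hA.isRegularLocalRing_quotient
  let r : Fin (n + 1) → ℕ := fun i => (maximalIdeal (A.carrier ⧸ A.ideal i)).spanFinrank
  have hr : ∀ i, ringKrullDim (A.carrier ⧸ A.ideal i) = r i := fun i =>
    (IsRegularLocalRing.spanFinrank_maximalIdeal (R := A.carrier ⧸ A.ideal i)).symm
  have hstep : ∀ i : Fin n, r i.succ + 1 ≤ r i.castSucc := fun i => by
    have := hA.isPrime i.castSucc
    have := ringKrullDim_quotient_add_one_le_of_lt (hA.strictMono i.castSucc_lt_succ)
    rw [hr, hr] at this
    exact_mod_cast this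
  have h0 : r 0 ≤ n := by
    have := ringKrullDim_le_of_surjective (Ideal.Quotient.mk (A.ideal 0))
      Ideal.Quotient.mk_surjective
    rw [hr, hA.ringKrullDim_eq] at this
    exact_mod_cast this
  have hup : ∀ i, r i + i ≤ n := by
    intro i
    induction i using Fin.induction with
    | zero => simpa using h0
    | succ i ih =>
      have := hstep i
      simp only [Fin.val_castSucc, Fin.val_succ] at ih ⊢
      omega
  have hlow : ∀ i, n ≤ r i + i := by
    intro i
    induction i using Fin.reverseInduction with
    | last => simp
    | cast i ih =>
      have := hstep i
      simp only [Fin.val_castSucc, Fin.val_succ] at ih ⊢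
      omega
  exact ⟨r i, le_antisymm (hup i) (hlow i), hr i⟩

theorem ideal_zero (hA : A.IsRegularChain) : A.ideal 0 = ⊥ := by
  have := hA.isRegularLocalRing
  have : IsDomain A.carrier := isDomain_of_spanFinrank_le n
    (by
      have := IsRegularLocalRing.spanFinrank_maximalIdeal (R := A.carrier)
      rw [hA.ringKrullDim_eq] at this
      exact (by exact_mod_cast this : _ = n).le)
    hA.ringKrullDim_eq.ge
  by_contra h
  obtain ⟨r, hr, hdim⟩ := hA.ringKrullDim_quotient_eq 0
  have h1 := ringKrullDim_quotient_add_one_le h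
  rw [hdim, hA.ringKrullDim_eq] at h1
  have h2 : r + 1 ≤ n := by exact_mod_cast h1
  simp only [Fin.val_zero] at hr
  omega

theorem isMaximal (hA : A.IsRegularChain) : (A.ideal (Fin.last n)).IsMaximal := by
  have := hA.isRegularLocalRing_quotient (Fin.last n)
  obtain ⟨r, hr, hdim⟩ := hA.ringKrullDim_quotient_eq (Fin.last n)
  have h0 : (maximalIdeal (A.carrier ⧸ A.ideal (Fin.last n))).spanFinrank = 0 := by
    have := IsRegularLocalRing.spanFinrank_maximalIdeal (R := A.carrier ⧸ A.ideal (Fin.last n))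
    rw [hdim] at this
    rw [show (maximalIdeal (A.carrier ⧸ A.ideal (Fin.last n))).spanFinrank = r by
      exact_mod_cast this]
    simpa using hr
  exact Ideal.Quotient.maximal_of_isField _ (isField_iff_maximalIdeal_eq.mpr
    ((Submodule.spanFinrank_eq_zero_iff_eq_bot (IsNoetherian.noetherian _)).mp h0))

/-- The ring `A/𝔭ᵢ` and its prime `𝔭ᵢ₊₁/𝔭ᵢ` satisfy the hypotheses of
`exists_eq_span_singleton_of_isRegularLocalRing_quotient`; the generator is lifted to `A`. -/
theorem exists_succ (hA : A.IsRegularChain) (i : Fin n) : ∃ x ∉ A.ideal i.castSucc,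
    A.ideal i.succ = A.ideal i.castSucc ⊔ Ideal.span {x} := by
  have hlt := hA.strictMono i.castSucc_lt_succ
  have := hA.isRegularLocalRing_quotient i.castSucc
  have hreg := hA.isRegularLocalRing_quotient i.succ
  have := hA.isPrime i.succ
  obtain ⟨d, hd, hdim⟩ := hA.ringKrullDim_quotient_eq i.succ
  obtain ⟨r, hr, hdim'⟩ := hA.ringKrullDim_quotient_eq i.castSucc
  have hrd : r = d + 1 := by
    simp only [Fin.val_castSucc, Fin.val_succ] at hr hd
    omega
  subst hrd
  let P := (A.ideal i.succ).map (Ideal.Quotient.mk (A.ideal i.castSucc))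
  let e := DoubleQuot.quotQuotEquivQuotOfLE hlt.le
  have hP : P.IsPrime := Ideal.isPrime_map_quotientMk_of_isPrime hlt.le
  have : IsRegularLocalRing ((A.carrier ⧸ A.ideal i.castSucc) ⧸ P) :=
    IsRegularLocalRing.of_ringEquiv e.symm
  have hdimP : ringKrullDim ((A.carrier ⧸ A.ideal i.castSucc) ⧸ P) = d :=
    (ringKrullDim_eq_of_ringEquiv e).trans hdim
  have h1 := IsRegularLocalRing.spanFinrank_maximalIdeal (R := A.carrier ⧸ A.ideal i.castSucc)
  have h2 := IsRegularLocalRing.spanFinrank_maximalIdeal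
    (R := (A.carrier ⧸ A.ideal i.castSucc) ⧸ P)
  rw [hdim'] at h1
  rw [hdimP] at h2
  obtain ⟨x, hx⟩ := exists_eq_span_singleton_of_isRegularLocalRing_quotient (P := P) (d := d)
    (by exact_mod_cast h1.le) hdim'.ge (by exact_mod_cast h2.le) hdimP.ge
  obtain ⟨x, rfl⟩ := Ideal.Quotient.mk_surjective x
  have heq : A.ideal i.succ = A.ideal i.castSucc ⊔ Ideal.span {x} := by
    have := congrArg (Ideal.comap (Ideal.Quotient.mk (A.ideal i.castSucc))) hx
    rw [Ideal.comap_map_of_surjective' _ Ideal.Quotient.mk_surjective, Ideal.mk_ker,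
      sup_eq_left.mpr hlt.le, ← Set.image_singleton, ← Ideal.map_span,
      Ideal.comap_map_of_surjective' _ Ideal.Quotient.mk_surjective, Ideal.mk_ker, sup_comm] at this
    exact this
  refine ⟨x, fun hmem => hlt.ne ?_, heq⟩
  rw [heq, eq_comm, sup_eq_left]
  exact (Ideal.span_singleton_le_iff_mem _).mpr hmem

theorem isPrincipalChain (hA : A.IsRegularChain) : A.IsPrincipalChain where
  isNoetherianRing := have := hA.isRegularLocalRing; inferInstance
  isLocalRing := hA.isRegularLocalRing.toIsLocalRing
  isMaximal := hA.isMaximal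
  ideal_zero := hA.ideal_zero
  isPrime := hA.isPrime
  exists_succ := hA.exists_succ

end IsRegularChain

end FlaggedRing

/-! ### Noetherian domains by completeness -/

section AdicComplete

variable {S : Type*} [CommRing S] (I : Ideal S) {x : S}

/-- By Cohen's theorem it suffices to treat primes `P`. If `x ∉ P`, lift generators of `P` modulo
`x` to `tᵢ ∈ P`. Each `g ∈ P` is a combination of the `tᵢ` plus `x * g'`, with `g' ∈ P` by
primality; iterating, the coefficients become convergent power series in `x`. -/
theorem isNoetherianRing_of_isAdicComplete [IsAdicComplete I S] (hx : x ∈ I)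
    (h : IsNoetherianRing (S ⧸ Ideal.span {x})) : IsNoetherianRing S := by
  have hker : RingHom.ker (Ideal.Quotient.mk (Ideal.span {x})) = Ideal.span {x} := Ideal.mk_ker
  refine IsNoetherianRing.of_prime fun P hP => ?_
  by_cases hxP : x ∈ P
  · refine Ideal.fg_of_fg_map_of_fg_inf_ker_of_surjective (f := Ideal.Quotient.mk (Ideal.span {x}))
      (IsNoetherian.noetherian _) ?_ Ideal.Quotient.mk_surjective
    rw [hker, inf_eq_right.mpr ((Ideal.span_singleton_le_iff_mem P).mpr hxP)]
    exact Submodule.fg_span_singleton x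
  obtain ⟨m, u, hu⟩ := Submodule.fg_iff_exists_fin_generating_family.mp
    (IsNoetherian.noetherian (P.map (Ideal.Quotient.mk (Ideal.span {x}))))
  have hlift : ∀ i, ∃ t ∈ P, Ideal.Quotient.mk (Ideal.span {x}) t = u i := fun i =>
    (Ideal.mem_map_iff_of_surjective _ Ideal.Quotient.mk_surjective).mp
      (hu ▸ Submodule.subset_span ⟨i, rfl⟩)
  choose t htP ht using hlift
  have hstep : ∀ g : P, ∃ (c : Fin m → S) (g' : P), (g : S) = ∑ i, c i * t i + x * g' := by
    intro g
    have hg : Ideal.Quotient.mk (Ideal.span {x}) g ∈ Submodule.span (S ⧸ Ideal.span {x}) (Set.range u) := by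
      rw [hu]
      exact Ideal.mem_map_of_mem _ g.2
    obtain ⟨c, hc⟩ := (Submodule.mem_span_range_iff_exists_fun (S ⧸ Ideal.span {x})).mp hg
    choose c' hc' using fun i => Ideal.Quotient.mk_surjective (c i)
    have hmem : (g : S) - ∑ i, c' i * t i ∈ Ideal.span {x} := by
      refine Ideal.Quotient.eq.mp ?_
      rw [map_sum, ← hc]
      simp [hc', ht]
    obtain ⟨z, hz⟩ := Ideal.mem_span_singleton'.mp hmem
    have hzP : z * x ∈ P := by
      rw [hz]
      exact sub_mem g.2 (sum_mem fun i _ => Ideal.mul_mem_left _ _ (htP i))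
    exact ⟨c', ⟨z, (hP.mem_or_mem hzP).resolve_right hxP⟩, by linear_combination -hz⟩
  choose c r hr using hstep
  have hspan : P = Ideal.span (Set.range t) := by
    refine le_antisymm (fun g hg => ?_) (Ideal.span_le.mpr (Set.range_subset_iff.mpr htP))
    -- `G k` is the remainder after `k` divisions, and `C i k` below is the `k`-th partial sum of
    -- the coefficient of `t i`.
    let G : ℕ → P := fun k => r^[k] ⟨g, hg⟩
    have hG : ∀ k, G (k + 1) = r (G k) := fun k => Function.iterate_succ_apply' r k _
    let C : Fin m → ℕ → S := fun i k => ∑ j ∈ Finset.range k, x ^ j * c (G j) i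
    have hC : ∀ k, g = ∑ i, C i k * t i + x ^ k * G k := by
      intro k
      induction k with
      | zero => simp [C, G]
      | succ k ih =>
        have h1 : ∑ i, C i (k + 1) * t i =
            ∑ i, C i k * t i + x ^ k * ∑ i, c (G k) i * t i := by
          rw [Finset.mul_sum, ← Finset.sum_add_distrib]
          refine Finset.sum_congr rfl fun i _ => ?_
          simp only [C, Finset.sum_range_succ]
          ring
        rw [h1, hG, ih.trans (congrArg _ (congrArg _ (hr (G k))))]
        ring
    have hcauchy : ∀ i {k l : ℕ}, k ≤ l → C i k ≡ C i l [SMOD (I ^ k • ⊤ : Submodule S S)] := by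
      intro i k l hkl
      rw [SModEq.comm, SModEq.sub_mem]
      simp only [C, smul_eq_mul, Ideal.mul_top]
      rw [← Finset.sum_range_add_sum_Ico _ hkl, add_sub_cancel_left]
      exact sum_mem fun j hj => Ideal.mul_mem_right _ _
        (Ideal.pow_le_pow_right (Finset.mem_Ico.mp hj).1 (Ideal.pow_mem_pow hx j))
    choose L hL using fun i =>
      IsPrecomplete.prec (inferInstance : IsPrecomplete I S) (fun {k l} => hcauchy i (k := k) (l := l))
    have hgL : g - ∑ i, L i * t i = 0 := by
      refine IsHausdorff.haus (inferInstance : IsHausdorff I S) _ fun k => ?_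
      have h1 : g - ∑ i, L i * t i = ∑ i, (C i k - L i) * t i + x ^ k * G k := by
        simp only [sub_mul, Finset.sum_sub_distrib]
        linear_combination hC k
      rw [SModEq.zero, h1, smul_eq_mul, Ideal.mul_top]
      refine add_mem (sum_mem fun i _ => Ideal.mul_mem_right _ _ ?_)
        (Ideal.mul_mem_right _ _ (Ideal.pow_mem_pow hx k))
      simpa [SModEq.sub_mem] using hL i k
    rw [sub_eq_zero.mp hgL]
    exact sum_mem fun i _ => Ideal.mul_mem_left _ _ (Ideal.subset_span ⟨i, rfl⟩)
  rw [hspan]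
  exact Submodule.fg_span (Set.finite_range t)

/-- Separatedness lets every nonzero element be written `x ^ k * b` with `b ∉ (x)`. In a vanishing
product the powers of `x` cancel, leaving a product of two such `b` equal to zero, against primality
of `(x)`. -/
theorem isDomain_of_isHausdorff [IsHausdorff I S] (hx : x ∈ I) (hreg : IsSMulRegular S x)
    (hP : (Ideal.span {x}).IsPrime) : IsDomain S := by
  have hdiv : ∀ a : S, a ≠ 0 → ∃ (k : ℕ) (b : S), b ∉ Ideal.span {x} ∧ a = x ^ k * b := by
    intro a ha
    by_contra! hcon
    have hpow : ∀ k : ℕ, ∃ b, a = x ^ k * b := by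
      intro k
      induction k with
      | zero => exact ⟨a, by simp⟩
      | succ k ih =>
        obtain ⟨b, hb⟩ := ih
        obtain ⟨c, rfl⟩ := Ideal.mem_span_singleton'.mp
          (not_not.mp fun hb' => hcon k b hb' hb)
        exact ⟨c, by rw [hb]; ring⟩
    refine ha (IsHausdorff.haus ‹IsHausdorff I S› a fun k => ?_)
    obtain ⟨b, rfl⟩ := hpow k
    rw [SModEq.zero]
    simpa using Ideal.mul_mem_right b _ (Ideal.pow_mem_pow hx k)
  have : Nontrivial S := ⟨x, 1, fun h => hP.ne_top (by rw [h, Ideal.span_singleton_one])⟩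
  refine @NoZeroDivisors.to_isDomain S _ _ ⟨fun {a b} hab => ?_⟩
  by_contra! hne
  obtain ⟨k, a', ha', rfl⟩ := hdiv a hne.1
  obtain ⟨l, b', hb', rfl⟩ := hdiv b hne.2
  have h0 : a' * b' = 0 := by
    refine hreg.pow (k + l) ?_
    simp only [smul_eq_mul, mul_zero]
    rw [← hab]
    ring
  rcases hP.mem_or_mem (show a' * b' ∈ Ideal.span {x} by rw [h0]; exact zero_mem _) with h | h
  · exact ha' h
  · exact hb' h

end AdicComplete

/-! ### Functoriality and exactness of completion -/

namespace AdicCompletion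

variable {R S T : Type*} [CommRing R] [CommRing S] [CommRing T] (I : Ideal R) (J : Ideal S)
  (K : Ideal T)

variable {I J} in
theorem factorPow_comp_quotientMap_comp_evalₐ (f : R →+* S)
    (h : ∀ k, I ^ k ≤ (J ^ k).comap f) {k l : ℕ} (hkl : k ≤ l) :
    (Ideal.Quotient.factorPow J hkl).comp
      ((Ideal.quotientMap (J ^ l) f (h l)).comp (evalₐ I l).toRingHom) =
      (Ideal.quotientMap (J ^ k) f (h k)).comp (evalₐ I k).toRingHom := by
  refine RingHom.ext fun x => ?_
  obtain ⟨a, rfl⟩ := AdicCompletion.mk_surjective _ _ x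
  change Ideal.Quotient.factorPow _ hkl (Ideal.quotientMap _ f (h l)
    (AdicCompletion.evalₐ _ l (AdicCompletion.mk _ _ a))) =
    Ideal.quotientMap _ f (h k) (AdicCompletion.evalₐ _ k (AdicCompletion.mk _ _ a))
  rw [AdicCompletion.evalₐ_mk, AdicCompletion.evalₐ_mk, Ideal.quotientMap_mk,
    Ideal.quotientMap_mk]
  refine Ideal.Quotient.eq.mpr ?_
  rw [← map_sub]
  exact h k (Ideal.Quotient.eq.mp (AdicCompletion.Ideal.mk_eq_mk I hkl a))

variable {I J} in
theorem pow_le_comap_pow {f : R →+* S} (h : I ≤ J.comap f) (k : ℕ) : I ^ k ≤ (J ^ k).comap f :=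
  (Ideal.pow_right_mono h k).trans (Ideal.le_comap_pow f k)

/-- The ring homomorphism of completions induced by `f : R → S` with `f(I) ⊆ J`. -/
noncomputable def mapRingHom (f : R →+* S) (h : I ≤ J.comap f) :
    AdicCompletion I R →+* AdicCompletion J S :=
  liftRingHom J (fun k => (Ideal.quotientMap (J ^ k) f (pow_le_comap_pow h k)).comp
      (evalₐ I k).toRingHom)
    (factorPow_comp_quotientMap_comp_evalₐ f (pow_le_comap_pow h))

variable {I J K}

theorem evalₐ_mapRingHom (f : R →+* S) (h : I ≤ J.comap f) (k : ℕ) (x : AdicCompletion I R) :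
    evalₐ J k (mapRingHom I J f h x) =
      Ideal.quotientMap (J ^ k) f (pow_le_comap_pow h k) (evalₐ I k x) :=
  evalₐ_liftRingHom J _ (factorPow_comp_quotientMap_comp_evalₐ f (pow_le_comap_pow h)) k x

theorem evalₐ_mapRingHom_mk (f : R →+* S) (h : I ≤ J.comap f) (k : ℕ)
    (a : AdicCauchySequence I R) :
    evalₐ J k (mapRingHom I J f h (mk I R a)) = Ideal.Quotient.mk (J ^ k) (f (a k)) := by
  rw [evalₐ_mapRingHom, evalₐ_mk, Ideal.quotientMap_mk]

theorem mapRingHom_algebraMap (f : R →+* S) (h : I ≤ J.comap f) (r : R) :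
    mapRingHom I J f h (algebraMap R _ r) = algebraMap S _ (f r) := by
  refine ext_evalₐ fun k => ?_
  rw [evalₐ_mapRingHom, AlgHom.commutes]
  exact (AlgHom.commutes (evalₐ J k) (f r)).symm

theorem mapRingHom_id (h : I ≤ I.comap (RingHom.id R)) :
    mapRingHom I I (RingHom.id R) h = RingHom.id _ := by
  refine RingHom.ext fun x => ext_evalₐ fun k => ?_
  obtain ⟨a, rfl⟩ := mk_surjective _ _ x
  rw [evalₐ_mapRingHom_mk, RingHom.id_apply, RingHom.id_apply, evalₐ_mk]

theorem mapRingHom_comp (f : R →+* S) (h : I ≤ J.comap f) (g : S →+* T) (h' : J ≤ K.comap g)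
    (h'' : I ≤ K.comap (g.comp f)) :
    mapRingHom I K (g.comp f) h'' = (mapRingHom J K g h').comp (mapRingHom I J f h) := by
  refine RingHom.ext fun x => ext_evalₐ fun k => ?_
  obtain ⟨a, rfl⟩ := mk_surjective _ _ x
  change _ = evalₐ K k (mapRingHom J K g h' (mapRingHom I J f h (mk I R a)))
  rw [evalₐ_mapRingHom_mk, evalₐ_mapRingHom, evalₐ_mapRingHom_mk, Ideal.quotientMap_mk,
    RingHom.comp_apply]

theorem mapRingHom_congr {f g : R →+* S} (hfg : f = g) (h : I ≤ J.comap f)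
    (h' : I ≤ J.comap g) : mapRingHom I J f h = mapRingHom I J g h' := by
  subst hfg
  rfl

/-- A Cauchy sequence is lifted term by term: its successive differences lie in `J ^ k = f(I ^ k)`,
so each lift is the previous one corrected by an element of `I ^ k`. -/
theorem mapRingHom_surjective {f : R →+* S} (hf : Function.Surjective f) (hJ : I.map f = J) :
    Function.Surjective (mapRingHom I J f (Ideal.map_le_iff_le_comap.mp hJ.le)) := by
  intro y
  obtain ⟨b, rfl⟩ := mk_surjective _ _ y
  have hlift : ∀ k, ∀ s ∈ J ^ k, ∃ r ∈ I ^ k, f r = s := fun k s hs => by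
    rw [← hJ, ← Ideal.map_pow] at hs
    exact (Ideal.mem_map_iff_of_surjective f hf).mp hs
  have hb : ∀ k, b (k + 1) - b k ∈ J ^ k := fun k =>
    Ideal.Quotient.eq.mp (Ideal.mk_eq_mk J k.le_succ b)
  let a : ∀ k : ℕ, {r : R // f r = b k} := fun k => Nat.rec
    ⟨(hf (b 0)).choose, (hf (b 0)).choose_spec⟩
    (fun k r => ⟨r.1 + (hlift k _ (hb k)).choose, by
      rw [map_add, r.2, (hlift k _ (hb k)).choose_spec.2]; ring⟩) k
  have ha : ∀ k, (a (k + 1)).1 = (a k).1 + (hlift k _ (hb k)).choose := fun k => rfl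
  refine ⟨mk I R (AdicCauchySequence.mk I R (fun k => (a k).1) fun k => ?_), ?_⟩
  · rw [SModEq.sub_mem, ha]
    simpa using (hlift k _ (hb k)).choose_spec.1
  · refine ext_evalₐ fun k => ?_
    rw [evalₐ_mapRingHom_mk, evalₐ_mk]
    exact congrArg _ (a k).2

/-- Completion is exact on `0 → ker f → R → R/ker f → 0`, and the completion of the finitely
generated module `ker f` is covered by `R̂ ⊗ ker f`, whose image in `R̂` is the extended ideal. -/
theorem ker_mapRingHom [IsNoetherianRing R] {f : R →+* S} (hf : Function.Surjective f)
    (hJ : I.map f = J) :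
    RingHom.ker (mapRingHom I J f (Ideal.map_le_iff_le_comap.mp hJ.le)) =
      (RingHom.ker f).map (algebraMap R (AdicCompletion I R)) := by
  apply le_antisymm
  · intro x hx
    obtain ⟨a, rfl⟩ := mk_surjective _ _ x
    have ha : ∀ k, a k ∈ RingHom.ker f ⊔ I ^ k := fun k => by
      have h1 := evalₐ_mapRingHom_mk f (Ideal.map_le_iff_le_comap.mp hJ.le) k a
      rw [RingHom.mem_ker.mp hx, _root_.map_zero, eq_comm, Ideal.Quotient.eq_zero_iff_mem, ← hJ,
        ← Ideal.map_pow, ← Ideal.mem_comap, Ideal.comap_map_of_surjective' f hf, sup_comm] at h1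
      exact h1
    have hexact := map_exact (I := I) (f := (RingHom.ker f).subtype) (g := (RingHom.ker f).mkQ)
      (Submodule.subtype_injective _) (LinearMap.exact_subtype_mkQ _) (Submodule.mkQ_surjective _)
    obtain ⟨z, hz⟩ := (hexact (mk I R a)).mp (by
      refine AdicCompletion.ext fun k => ?_
      rw [map_mk, mk_apply_coe, val_zero_apply, Submodule.mkQ_apply, Submodule.Quotient.mk_eq_zero]
      obtain ⟨c, hc, d, hd, hcd⟩ := Submodule.mem_sup.mp (ha k)
      rw [AdicCauchySequence.map_apply_coe, ← hcd, map_add, Submodule.mkQ_apply,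
        (Submodule.Quotient.mk_eq_zero _).mpr hc, zero_add, ← mul_one d, ← smul_eq_mul, map_smul]
      exact Submodule.smul_mem_smul hd trivial)
    obtain ⟨w, rfl⟩ := ofTensorProduct_surjective_of_finite I (RingHom.ker f) z
    rw [← hz]
    clear hz hx ha
    induction w with
    | zero => simp
    | add v w hv hw =>
      rw [map_add, map_add]
      exact add_mem hv hw
    | tmul r k =>
      rw [ofTensorProduct_tmul, map_smul, map_of]
      exact Ideal.mul_mem_left _ r (Ideal.mem_map_of_mem _ k.2)
  · rw [Ideal.map_le_iff_le_comap]
    intro k hk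
    rw [Ideal.mem_comap, RingHom.mem_ker, mapRingHom_algebraMap, RingHom.mem_ker.mp hk, _root_.map_zero]

end AdicCompletion

/-! ### Completion of principal chains -/

theorem Ideal.IsPrime.of_comap_surjective {R S : Type*} [CommRing R] [CommRing S] {f : R →+* S}
    (hf : Function.Surjective f) {P : Ideal S} (hP : (P.comap f).IsPrime) : P.IsPrime where
  ne_top' h := hP.ne_top (by rw [h, Ideal.comap_top])
  mem_or_mem' {a b} hab := by
    obtain ⟨a, rfl⟩ := hf a
    obtain ⟨b, rfl⟩ := hf b
    exact hP.mem_or_mem (show a * b ∈ P.comap f by rwa [Ideal.mem_comap, map_mul])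

namespace AdicCompletion

variable {R : Type*} [CommRing R] [IsNoetherianRing R] {I : Ideal R}

/-- `KR̂` is the kernel of the map to the completion of `R/K`, and `R/K` embeds in its completion by
Krull's intersection theorem. -/
theorem comap_map_algebraMap [IsLocalRing R] {K : Ideal R} (hKI : K ≤ I) (hI : I ≠ ⊤) :
    (K.map (algebraMap R (AdicCompletion I R))).comap (algebraMap R (AdicCompletion I R)) = K := by
  have hK : K ≠ ⊤ := fun h => hI (top_le_iff.mp (h ▸ hKI))
  have := isLocalRing_quotient hK
  have hJ : I.map (Ideal.Quotient.mk K) ≠ ⊤ := fun h => hI (by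
    have := congrArg (Ideal.comap (Ideal.Quotient.mk K)) h
    rwa [Ideal.comap_map_of_surjective' _ Ideal.Quotient.mk_surjective, Ideal.mk_ker,
      sup_eq_left.mpr hKI, Ideal.comap_top] at this)
  have : IsHausdorff (I.map (Ideal.Quotient.mk K)) (R ⧸ K) := IsHausdorff.of_isLocalRing _ _ hJ
  refine le_antisymm (fun a ha => ?_) Ideal.le_comap_map
  have hker := ker_mapRingHom (I := I) (J := I.map (Ideal.Quotient.mk K))
    (Ideal.Quotient.mk_surjective (I := K)) rfl
  rw [Ideal.mk_ker] at hker
  rw [Ideal.mem_comap, ← hker, RingHom.mem_ker, mapRingHom_algebraMap] at ha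
  rw [← Ideal.Quotient.eq_zero_iff_mem]
  exact (map_eq_zero_iff (of (I.map (Ideal.Quotient.mk K)) (R ⧸ K)) (of_injective _ _)).mp ha

/-- The inductive step down the flag. The completion of `R/p` is `R̂/pR̂`, and its quotient by `x`
is `R̂/p'R̂`; since `x` is regular on it by flatness, the two completeness criteria apply. -/
theorem isPrime_map_of_eq_sup {p p' : Ideal R} [p.IsPrime] {x : R} (hxI : x ∈ I)
    (hxp : x ∉ p) (hp' : p' = p ⊔ Ideal.span {x})
    (hprime : (p'.map (algebraMap R (AdicCompletion I R))).IsPrime)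
    (hnoeth : IsNoetherianRing (AdicCompletion I R ⧸
      p'.map (algebraMap R (AdicCompletion I R)))) :
    (p.map (algebraMap R (AdicCompletion I R))).IsPrime ∧
      IsNoetherianRing (AdicCompletion I R ⧸ p.map (algebraMap R (AdicCompletion I R))) := by
  let J := I.map (Ideal.Quotient.mk p)
  let φ : AdicCompletion I R →+* AdicCompletion J (R ⧸ p) :=
    mapRingHom I J (Ideal.Quotient.mk p) (Ideal.map_le_iff_le_comap.mp le_rfl)
  have hφ : Function.Surjective φ := mapRingHom_surjective Ideal.Quotient.mk_surjective rfl
  have hker : RingHom.ker φ = p.map (algebraMap R (AdicCompletion I R)) := by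
    have := ker_mapRingHom (I := I) (J := J) (Ideal.Quotient.mk_surjective (I := p)) rfl
    rwa [Ideal.mk_ker] at this
  let y : AdicCompletion J (R ⧸ p) := algebraMap (R ⧸ p) _ (Ideal.Quotient.mk p x)
  have hy : φ (algebraMap R _ x) = y := mapRingHom_algebraMap _ _ x
  have hcomap : (Ideal.span {y}).comap φ =
      p'.map (algebraMap R (AdicCompletion I R)) := by
    rw [hp', ← hy, ← Set.image_singleton, ← Ideal.map_span, Ideal.comap_map_of_surjective' φ hφ, hker,
      Ideal.map_sup, Ideal.map_span, Set.image_singleton, sup_comm]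
  have hJfg : J.FG := IsNoetherian.noetherian J
  have hcomplete := isAdicComplete_self J hJfg
  have hyJ : y ∈ J.map (algebraMap (R ⧸ p) (AdicCompletion J (R ⧸ p))) :=
    Ideal.mem_map_of_mem _ (Ideal.mem_map_of_mem _ hxI)
  have hx0 : Ideal.Quotient.mk p x ≠ 0 := fun h => hxp (Ideal.Quotient.eq_zero_iff_mem.mp h)
  have hreg : IsSMulRegular (AdicCompletion J (R ⧸ p)) y :=
    IsSMulRegular.of_flat (S := AdicCompletion J (R ⧸ p)) (IsSMulRegular.of_ne_zero hx0)
  have hyprime : (Ideal.span {y}).IsPrime := by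
    rw [← hcomap] at hprime
    exact Ideal.IsPrime.of_comap_surjective hφ hprime
  have hdom : IsDomain (AdicCompletion J (R ⧸ p)) := isDomain_of_isHausdorff _ hyJ hreg hyprime
  have hyn : IsNoetherianRing (AdicCompletion J (R ⧸ p) ⧸ Ideal.span {y}) :=
    isNoetherianRing_of_surjective _ _ (Ideal.quotientMap (Ideal.span {y}) φ hcomap.ge)
      (Ideal.quotientMap_surjective hφ)
  have hn : IsNoetherianRing (AdicCompletion J (R ⧸ p)) :=
    isNoetherianRing_of_isAdicComplete _ hyJ hyn
  rw [← hker]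
  exact ⟨RingHom.ker_isPrime φ,
    isNoetherianRing_of_ringEquiv _ (RingHom.quotientKerEquivOfSurjective hφ).symm⟩

end AdicCompletion

namespace FlaggedRing

open IsLocalRing

variable {n : ℕ} {A B : FlaggedRing.{u} n}

/-- The canonical homomorphism from `A` to its completion. -/
noncomputable def toComp (A : FlaggedRing.{u} n) : A.carrier →+* A.comp.carrier :=
  algebraMap A.carrier (AdicCompletion (A.ideal (Fin.last n)) A.carrier)

theorem comp_ideal (i : Fin (n + 1)) : A.comp.ideal i = (A.ideal i).map A.toComp := rfl

namespace IsPrincipalChain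

theorem comap_toComp (hA : A.IsPrincipalChain) (i : Fin (n + 1)) :
    (A.comp.ideal i).comap A.toComp = A.ideal i := by
  have := hA.isNoetherianRing
  have := hA.isLocalRing
  exact AdicCompletion.comap_map_algebraMap (hA.monotone (Fin.le_last i)) hA.isMaximal.ne_top

theorem isMaximal_comp (hA : A.IsPrincipalChain) : (A.comp.ideal (Fin.last n)).IsMaximal := by
  have := hA.isNoetherianRing
  have := hA.isMaximal
  exact AdicCompletion.isMaximal_map_of_le _ _ le_rfl (IsNoetherian.noetherian _)

theorem isPrime_comp_and_isNoetherianRing (hA : A.IsPrincipalChain) (i : Fin (n + 1)) :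
    (A.comp.ideal i).IsPrime ∧ IsNoetherianRing (A.comp.carrier ⧸ A.comp.ideal i) := by
  have := hA.isNoetherianRing
  have := hA.isLocalRing
  have := hA.isPrime
  induction i using Fin.reverseInduction with
  | last =>
    have hmax := hA.isMaximal_comp
    let := Ideal.Quotient.field (A.comp.ideal (Fin.last n))
    exact ⟨hmax.isPrime, inferInstance⟩
  | cast i ih =>
    obtain ⟨x, hx, hsucc⟩ := hA.exists_succ i
    have hxI : x ∈ A.ideal (Fin.last n) := hA.monotone (Fin.le_last i.succ) (hsucc ▸
      Ideal.mem_sup_right (Ideal.mem_span_singleton_self x))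
    exact AdicCompletion.isPrime_map_of_eq_sup hxI hx hsucc ih.1 ih.2

theorem comp (hA : A.IsPrincipalChain) : A.comp.IsPrincipalChain where
  isNoetherianRing := by
    have h0 : A.comp.ideal 0 = ⊥ := by
      rw [comp_ideal, hA.ideal_zero, Ideal.map_bot]
    have := (hA.isPrime_comp_and_isNoetherianRing 0).2
    rw [h0] at this
    exact isNoetherianRing_of_ringEquiv _ (RingEquiv.quotientBot A.comp.carrier)
  isLocalRing := by
    have := hA.isNoetherianRing
    have : (A.comp.ideal (Fin.last n)).IsMaximal := hA.isMaximal_comp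
    have : IsAdicComplete (A.comp.ideal (Fin.last n)) A.comp.carrier :=
      AdicCompletion.isAdicComplete_self _ (IsNoetherian.noetherian _)
    exact isLocalRing_of_isAdicComplete_maximal (A.comp.ideal (Fin.last n))
  isMaximal := hA.isMaximal_comp
  ideal_zero := by
    rw [comp_ideal, hA.ideal_zero, Ideal.map_bot]
  isPrime i := (hA.isPrime_comp_and_isNoetherianRing i).1
  exists_succ i := by
    obtain ⟨x, hx, hsucc⟩ := hA.exists_succ i
    refine ⟨A.toComp x, ?_, ?_⟩
    · rw [← hA.comap_toComp] at hx
      exact hx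
    · rw [comp_ideal, hsucc, Ideal.map_sup, Ideal.map_span, Set.image_singleton, comp_ideal]

theorem isAdicComplete_comp (hA : A.IsPrincipalChain) :
    IsAdicComplete (A.comp.ideal (Fin.last n)) A.comp.carrier := by
  have := hA.isNoetherianRing
  exact AdicCompletion.isAdicComplete_self _ (IsNoetherian.noetherian _)

end IsPrincipalChain

/-! ### Pullback of flags along completed homomorphisms -/

theorem compMap_toComp (f : A.carrier →+* B.carrier) (hf : PullsBack f) (a : A.carrier) :
    compMap f hf (A.toComp a) = B.toComp (f a) :=
  AdicCompletion.mapRingHom_algebraMap f (hf (Fin.last n)).ge a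

/-- If `a + c * x ∈ P` with `a ∈ Q`, then `c * x ∈ P` and so `c ∈ P`. Thus `P ≤ Q + 𝔪P`, and
Nakayama applies. -/
theorem _root_.Ideal.IsPrime.eq_of_le_sup_span_singleton {R : Type*} [CommRing R]
    [IsNoetherianRing R] [IsLocalRing R] {P Q : Ideal R} (hP : P.IsPrime) {x : R} (hx : x ∈ maximalIdeal R)
    (hxP : x ∉ P) (hQP : Q ≤ P) (hPQ : P ≤ Q ⊔ Ideal.span {x}) : P = Q := by
  refine le_antisymm ?_ hQP
  refine Submodule.le_of_le_smul_of_le_jacobson_bot (IsNoetherian.noetherian P)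
    (maximalIdeal_le_jacobson _) fun z hz => ?_
  obtain ⟨a, ha, b, hb, rfl⟩ := Submodule.mem_sup.mp (hPQ hz)
  obtain ⟨c, rfl⟩ := Ideal.mem_span_singleton'.mp hb
  have hcx : c * x ∈ P := (Submodule.add_mem_iff_right P (hQP ha)).mp hz
  refine Submodule.add_mem_sup ha ?_
  rw [mul_comm]
  exact Submodule.smul_mem_smul hx ((hP.mem_or_mem hcx).resolve_right hxP)

/-- The preimage of `𝔮ᵢB̂` is a prime between `𝔭ᵢÂ` and `𝔭ᵢ₊₁Â = 𝔭ᵢÂ + (x)`, by descending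
induction. It avoids `x` because `𝔮ᵢB̂` contracts to `𝔮ᵢ` in `B` and then to `𝔭ᵢ` in `A`, so it
equals `𝔭ᵢÂ`. -/
theorem PullsBack.compMap {f : A.carrier →+* B.carrier} (hf : PullsBack f)
    (hA : A.IsPrincipalChain) (hB : B.IsPrincipalChain) :
    PullsBack (A := A.comp) (B := B.comp) (compMap f hf) := by
  have hA' := hA.comp
  have hB' := hB.comp
  have := hA'.isNoetherianRing
  have := hA'.isLocalRing
  have hle : ∀ i, A.comp.ideal i ≤ (B.comp.ideal i).comap (FlaggedRing.compMap f hf) := by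
    intro i
    rw [comp_ideal, Ideal.map_le_iff_le_comap]
    intro a ha
    rw [Ideal.mem_comap, Ideal.mem_comap, compMap_toComp, comp_ideal]
    rw [← hf i] at ha
    exact Ideal.mem_map_of_mem _ ha
  intro i
  induction i using Fin.reverseInduction with
  | last =>
    have := hB'.isPrime (Fin.last n)
    exact (hA'.isMaximal.eq_of_le (Ideal.IsPrime.ne_top inferInstance) (hle _)).symm
  | cast i ih =>
    have hP : ((B.comp.ideal i.castSucc).comap (FlaggedRing.compMap f hf)).IsPrime :=
      have := hB'.isPrime i.castSucc
      inferInstance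
    obtain ⟨x, hx, hsucc⟩ := hA.exists_succ i
    have hsucc' : A.comp.ideal i.succ = A.comp.ideal i.castSucc ⊔ Ideal.span
        {A.toComp x} := by
      rw [comp_ideal, hsucc, Ideal.map_sup, Ideal.map_span, Set.image_singleton, comp_ideal]
    refine hP.eq_of_le_sup_span_singleton
      (x := A.toComp x) ?_ ?_
      (hle _) ?_
    · rw [← hA'.maximalIdeal_eq]
      refine hA'.monotone (Fin.le_last i.succ) ?_
      rw [hsucc']
      exact Ideal.mem_sup_right (Ideal.mem_span_singleton_self _)
    · rw [Ideal.mem_comap, compMap_toComp, ← Ideal.mem_comap, hB.comap_toComp,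
        ← Ideal.mem_comap, hf]
      exact hx
    · rw [← hsucc', ← ih]
      exact Ideal.comap_mono (hB'.monotone i.castSucc_lt_succ.le)

end FlaggedRing

/-! ### Localisation of principal chains -/

namespace FlaggedRing

open IsLocalRing

section Loc

variable {m n : ℕ} {A B : FlaggedRing.{u} (n + 1)}

/-- The canonical homomorphism from `A` to its localisation. -/
noncomputable def toLoc (A : FlaggedRing.{u} (n + 1)) : A.carrier →+* A.loc.carrier :=
  algebraMap A.carrier (Localization A.locSubmonoid)

theorem loc_ideal (i : Fin (n + 1)) : A.loc.ideal i = (A.ideal i.castSucc).map A.toLoc := rfl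

noncomputable instance : Algebra A.carrier A.loc.carrier :=
  inferInstanceAs (Algebra A.carrier (Localization A.locSubmonoid))

instance : IsLocalization A.locSubmonoid A.loc.carrier :=
  inferInstanceAs (IsLocalization A.locSubmonoid (Localization A.locSubmonoid))

theorem algebraMap_loc : algebraMap A.carrier A.loc.carrier = A.toLoc := rfl

theorem map_comap_toLoc (P : Ideal A.loc.carrier) : (P.comap A.toLoc).map A.toLoc = P :=
  IsLocalization.map_under A.locSubmonoid A.loc.carrier P

theorem IsPrincipalChain.mem_locSubmonoid (hA : A.IsPrincipalChain) {x : A.carrier} :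
    x ∈ A.locSubmonoid ↔ x ∉ A.ideal (Fin.last n).castSucc := by
  have := hA.isPrime (Fin.last n).castSucc
  rw [A.locSubmonoid_eq, Ideal.mem_primeCompl_iff]

theorem IsPrincipalChain.disjoint_locSubmonoid (hA : A.IsPrincipalChain) (i : Fin (n + 1)) :
    Disjoint (A.locSubmonoid : Set A.carrier) (A.ideal i.castSucc) :=
  Set.disjoint_left.mpr fun _ hx hxi => hA.mem_locSubmonoid.mp hx
    (hA.monotone (Fin.castSucc_le_castSucc_iff.mpr (Fin.le_last i)) hxi)

theorem IsPrincipalChain.isPrime_loc (hA : A.IsPrincipalChain) (i : Fin (n + 1)) :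
    (A.loc.ideal i).IsPrime :=
  IsLocalization.isPrime_of_isPrime_disjoint A.locSubmonoid A.loc.carrier _ (hA.isPrime _)
    (hA.disjoint_locSubmonoid i)

theorem IsPrincipalChain.comap_toLoc (hA : A.IsPrincipalChain) (i : Fin (n + 1)) :
    (A.loc.ideal i).comap A.toLoc = A.ideal i.castSucc :=
  IsLocalization.under_map_of_isPrime_disjoint A.locSubmonoid A.loc.carrier (hA.isPrime _)
    (hA.disjoint_locSubmonoid i)

theorem isLocalization_atPrime (A : FlaggedRing.{u} (n + 1))
    [h : (A.ideal (Fin.last n).castSucc).IsPrime] :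
    IsLocalization.AtPrime A.loc.carrier (A.ideal (Fin.last n).castSucc) := by
  unfold IsLocalization.AtPrime
  rw [← A.locSubmonoid_eq]
  infer_instance

theorem IsPrincipalChain.loc (hA : A.IsPrincipalChain) : A.loc.IsPrincipalChain where
  isNoetherianRing :=
    have := hA.isNoetherianRing
    IsLocalization.isNoetherianRing A.locSubmonoid A.loc.carrier inferInstance
  isLocalRing :=
    have := hA.isPrime (Fin.last n).castSucc
    have := A.isLocalization_atPrime
    IsLocalization.AtPrime.isLocalRing A.loc.carrier (A.ideal (Fin.last n).castSucc)
  isMaximal := by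
    have := hA.isPrime (Fin.last n).castSucc
    have := A.isLocalization_atPrime
    have := IsLocalization.AtPrime.isLocalRing A.loc.carrier (A.ideal (Fin.last n).castSucc)
    rw [loc_ideal, ← algebraMap_loc, IsLocalization.AtPrime.map_eq_maximalIdeal]
    infer_instance
  ideal_zero := by
    rw [loc_ideal, Fin.castSucc_zero, hA.ideal_zero, Ideal.map_bot]
  isPrime := hA.isPrime_loc
  exists_succ i := by
    obtain ⟨x, hx, hsucc⟩ := hA.exists_succ i.castSucc
    refine ⟨A.toLoc x, ?_, ?_⟩
    · rwa [← Ideal.mem_comap, hA.comap_toLoc]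
    · rw [loc_ideal, ← Fin.succ_castSucc, hsucc, Ideal.map_sup, Ideal.map_span,
        Set.image_singleton, loc_ideal]

/-- The homomorphism of localisations induced by `f : A → C`. -/
noncomputable def locRingHom {C : FlaggedRing.{u} (m + 1)} (f : A.carrier →+* C.carrier)
    (h : A.locSubmonoid ≤ C.locSubmonoid.comap f) : A.loc.carrier →+* C.loc.carrier :=
  IsLocalization.map C.loc.carrier f h

theorem locRingHom_comp_toLoc {C : FlaggedRing.{u} (m + 1)} (f : A.carrier →+* C.carrier)
    (h : A.locSubmonoid ≤ C.locSubmonoid.comap f) :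
    (locRingHom f h).comp A.toLoc = C.toLoc.comp f :=
  IsLocalization.map_comp h

theorem loc_ringHom_ext {S : Type*} [CommRing S] {g h : A.loc.carrier →+* S}
    (H : g.comp A.toLoc = h.comp A.toLoc) : g = h :=
  IsLocalization.ringHom_ext (S := Localization A.locSubmonoid) A.locSubmonoid H

/-- An ideal of a localisation is extended from its contraction, so preimages can be computed before
localising. -/
theorem comap_locRingHom {C : FlaggedRing.{u} (m + 1)} (f : A.carrier →+* C.carrier)
    (h : A.locSubmonoid ≤ C.locSubmonoid.comap f) (P : Ideal C.loc.carrier) :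
    P.comap (locRingHom f h) = ((P.comap C.toLoc).comap f).map A.toLoc := by
  rw [Ideal.comap_comap, ← locRingHom_comp_toLoc f h, ← Ideal.comap_comap, map_comap_toLoc]

theorem PullsBack.locSubmonoid_le {f : A.carrier →+* B.carrier} (hf : PullsBack f) :
    A.locSubmonoid ≤ B.locSubmonoid.comap f :=
  Submonoid.closure_le.mpr fun x hx => Submonoid.subset_closure fun hx' => hx (by
    rw [SetLike.mem_coe, ← hf (Fin.last n).castSucc]
    exact hx')

theorem locMap_eq (f : A.carrier →+* B.carrier) (hf : PullsBack f) :
    locMap f hf = locRingHom f hf.locSubmonoid_le := rfl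

theorem PullsBack.locMap {f : A.carrier →+* B.carrier} (hf : PullsBack f)
    (hB : B.IsPrincipalChain) : PullsBack (A := A.loc) (B := B.loc) (locMap f hf) := by
  intro i
  rw [locMap_eq, comap_locRingHom, hB.comap_toLoc, hf, loc_ideal]

end Loc

/-! ### The quotient of a chain by its ideal `𝔭₁` -/

section Quotient

variable {n : ℕ}

/-- `q` identifies `C` with the quotient of the flagged ring `A` by `𝔭₁`. -/
structure IsQuotientMap {A : FlaggedRing.{u} (n + 1)} {C : FlaggedRing.{u} n}
    (q : A.carrier →+* C.carrier) : Prop where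
  surjective : Function.Surjective q
  ideal_zero : C.ideal 0 = ⊥
  comap_ideal : ∀ i, (C.ideal i).comap q = A.ideal i.succ

/-- The quotient of the flagged ring `A` by `𝔭₁`. -/
def quotient (A : FlaggedRing.{u} (n + 1)) : FlaggedRing.{u} n where
  carrier := A.carrier ⧸ A.ideal 1
  ideal i := (A.ideal i.succ).map (Ideal.Quotient.mk (A.ideal 1))

/-- The projection from `A` to its quotient by `𝔭₁`. -/
def toQuotient (A : FlaggedRing.{u} (n + 1)) : A.carrier →+* A.quotient.carrier :=
  Ideal.Quotient.mk (A.ideal 1)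

theorem IsPrincipalChain.isQuotientMap_toQuotient {A : FlaggedRing.{u} (n + 1)}
    (hA : A.IsPrincipalChain) : IsQuotientMap A.toQuotient where
  surjective := Ideal.Quotient.mk_surjective
  ideal_zero := Ideal.map_quotient_self (A.ideal 1)
  comap_ideal i := by
    change ((A.ideal i.succ).map (Ideal.Quotient.mk (A.ideal 1))).comap
      (Ideal.Quotient.mk (A.ideal 1)) = _
    rw [Ideal.comap_map_of_surjective' _ Ideal.Quotient.mk_surjective, Ideal.mk_ker, sup_eq_left]
    exact hA.monotone (Fin.succ_le_succ_iff.mpr (Fin.zero_le i))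

namespace IsQuotientMap

variable {A : FlaggedRing.{u} (n + 1)} {C : FlaggedRing.{u} n} {q : A.carrier →+* C.carrier}

theorem map_ideal (hq : IsQuotientMap q) (i : Fin (n + 1)) : (A.ideal i.succ).map q = C.ideal i := by
  rw [← hq.comap_ideal, Ideal.map_comap_of_surjective q hq.surjective]

theorem ker_eq (hq : IsQuotientMap q) : RingHom.ker q = A.ideal 1 := by
  rw [RingHom.ker_eq_comap_bot, ← hq.ideal_zero, hq.comap_ideal, Fin.succ_zero_eq_one]

theorem isPrincipalChain (hq : IsQuotientMap q) (hA : A.IsPrincipalChain) :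
    C.IsPrincipalChain := by
  have := hA.isNoetherianRing
  have := hA.isLocalRing
  have hprime : ∀ i, (C.ideal i).IsPrime := fun i =>
    Ideal.IsPrime.of_comap_surjective hq.surjective (hq.comap_ideal i ▸ hA.isPrime i.succ)
  have : Nontrivial C.carrier :=
    ⟨0, 1, fun h => (hprime 0).ne_top ((Ideal.eq_top_iff_one _).mpr (h ▸ zero_mem _))⟩
  exact {
    isNoetherianRing := isNoetherianRing_of_surjective _ _ q hq.surjective
    isLocalRing := .of_surjective' q hq.surjective
    isMaximal := by
      rw [← hq.map_ideal]
      have := hA.isMaximal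
      refine Ideal.IsMaximal.map_of_surjective_of_ker_le hq.surjective (m := A.ideal (Fin.last _)) ?_
      rw [hq.ker_eq]
      exact hA.monotone (Fin.le_last _)
    ideal_zero := hq.ideal_zero
    isPrime := hprime
    exists_succ := fun i => by
      obtain ⟨x, hx, hsucc⟩ := hA.exists_succ i.succ
      refine ⟨q x, ?_, ?_⟩
      · rwa [← Ideal.mem_comap, hq.comap_ideal]
      · rw [← hq.map_ideal, hsucc, Ideal.map_sup, Ideal.map_span, Set.image_singleton,
          ← Fin.succ_castSucc, hq.map_ideal] }

theorem ideal_last_le (hq : IsQuotientMap q) :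
    A.ideal (Fin.last (n + 1)) ≤ (C.ideal (Fin.last n)).comap q :=
  (hq.comap_ideal (Fin.last n)).ge

/-- The homomorphism of completions induced by a quotient map. -/
noncomputable def compMap (hq : IsQuotientMap q) : A.comp.carrier →+* C.comp.carrier :=
  AdicCompletion.mapRingHom (A.ideal (Fin.last (n + 1))) (C.ideal (Fin.last n)) q hq.ideal_last_le

theorem compMap_comp_toComp (hq : IsQuotientMap q) :
    hq.compMap.comp A.toComp = C.toComp.comp q :=
  RingHom.ext (AdicCompletion.mapRingHom_algebraMap q hq.ideal_last_le)

/-- Exactness of completion identifies the kernel with `𝔭₁Â`. The predicate `IsQuotientMap` is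
needed because the completed quotient is only isomorphic to the quotient of the completion. -/
theorem isQuotientMap_compMap (hq : IsQuotientMap q) (hA : A.IsPrincipalChain) :
    IsQuotientMap (A := A.comp) (C := C.comp) hq.compMap := by
  have := hA.isNoetherianRing
  have hsurj : Function.Surjective hq.compMap :=
    AdicCompletion.mapRingHom_surjective hq.surjective (hq.map_ideal (Fin.last n))
  have hker : RingHom.ker hq.compMap = A.comp.ideal 1 := by
    have := AdicCompletion.ker_mapRingHom hq.surjective (hq.map_ideal (Fin.last n))
    rw [hq.ker_eq] at this
    exact this
  refine ⟨hsurj, ?_, fun i => ?_⟩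
  · rw [comp_ideal, hq.ideal_zero, Ideal.map_bot]
  · rw [comp_ideal, ← hq.map_ideal, Ideal.map_map, ← hq.compMap_comp_toComp, ← Ideal.map_map,
      Ideal.comap_map_of_surjective' _ hsurj, hker, ← comp_ideal, sup_eq_left]
    exact hA.comp.monotone (Fin.succ_le_succ_iff.mpr (Fin.zero_le i))

end IsQuotientMap

namespace IsQuotientMap

variable {A : FlaggedRing.{u} (n + 2)} {C : FlaggedRing.{u} (n + 1)}
  {q : A.carrier →+* C.carrier}

theorem locSubmonoid_le (hq : IsQuotientMap q) : A.locSubmonoid ≤ C.locSubmonoid.comap q :=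
  Submonoid.closure_le.mpr fun x hx => Submonoid.subset_closure fun hx' => hx (by
    have := (hq.comap_ideal (Fin.last n).castSucc).le (show x ∈ _ from hx')
    exact this)

/-- The homomorphism of localisations induced by a quotient map. -/
noncomputable def locMap (hq : IsQuotientMap q) : A.loc.carrier →+* C.loc.carrier :=
  locRingHom q hq.locSubmonoid_le

/-- The prime at which `A` is localised is the preimage of the one for `C`, so every lift of a
denominator is again a denominator; this gives surjectivity. -/
theorem isQuotientMap_locMap (hq : IsQuotientMap q) (hA : A.IsPrincipalChain) :
    IsQuotientMap (A := A.loc) (C := C.loc) hq.locMap := by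
  have hC := hq.isPrincipalChain hA
  refine ⟨fun z => ?_, ?_, fun i => ?_⟩
  · obtain ⟨c, s, rfl⟩ := IsLocalization.exists_mk'_eq C.locSubmonoid z
    obtain ⟨a, rfl⟩ := hq.surjective c
    obtain ⟨s, hs⟩ := s
    obtain ⟨t, rfl⟩ := hq.surjective s
    have ht : t ∈ A.locSubmonoid := by
      rw [hA.mem_locSubmonoid]
      rw [hC.mem_locSubmonoid, ← Ideal.mem_comap, hq.comap_ideal] at hs
      exact hs
    exact ⟨IsLocalization.mk' A.loc.carrier a ⟨t, ht⟩,
      IsLocalization.map_mk' hq.locSubmonoid_le a ⟨t, ht⟩⟩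
  · rw [loc_ideal, Fin.castSucc_zero, hq.ideal_zero, Ideal.map_bot]
  · rw [locMap, comap_locRingHom, hC.comap_toLoc, hq.comap_ideal, loc_ideal, Fin.succ_castSucc]

end IsQuotientMap

end Quotient

end FlaggedRing

/-! ### Functoriality of `HL` -/

namespace FlaggedRing

open IsLocalRing

section HL

variable {n : ℕ}

theorem PullsBack.comp {A B C : FlaggedRing.{u} n} {f : A.carrier →+* B.carrier}
    {g : B.carrier →+* C.carrier} (hg : PullsBack g) (hf : PullsBack f) :
    PullsBack (g.comp f) := fun i => by
  rw [← Ideal.comap_comap, hg, hf]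

theorem PullsBack.le_last {A B : FlaggedRing.{u} n} {f : A.carrier →+* B.carrier}
    (hf : PullsBack f) : A.ideal (Fin.last n) ≤ (B.ideal (Fin.last n)).comap f :=
  (hf (Fin.last n)).ge

theorem compMap_comp {A B C : FlaggedRing.{u} n} {f : A.carrier →+* B.carrier}
    {g : B.carrier →+* C.carrier} (hg : PullsBack g) (hf : PullsBack f)
    (hgf : PullsBack (g.comp f)) :
    compMap (g.comp f) hgf = (compMap g hg).comp (compMap f hf) :=
  AdicCompletion.mapRingHom_comp f hf.le_last g hg.le_last hgf.le_last

theorem compMap_id {A : FlaggedRing.{u} n} (h : PullsBack (RingHom.id A.carrier)) :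
    compMap (RingHom.id A.carrier) h = RingHom.id A.comp.carrier :=
  AdicCompletion.mapRingHom_id h.le_last

theorem locMap_comp_toLoc {A B : FlaggedRing.{u} (n + 1)} {f : A.carrier →+* B.carrier}
    (hf : PullsBack f) : (locMap f hf).comp A.toLoc = B.toLoc.comp f :=
  locRingHom_comp_toLoc f hf.locSubmonoid_le

theorem locMap_comp {A B C : FlaggedRing.{u} (n + 1)} {f : A.carrier →+* B.carrier}
    {g : B.carrier →+* C.carrier} (hg : PullsBack g) (hf : PullsBack f)
    (hgf : PullsBack (g.comp f)) :
    locMap (g.comp f) hgf = (locMap g hg).comp (locMap f hf) :=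
  loc_ringHom_ext (by
    rw [locMap_comp_toLoc, RingHom.comp_assoc, locMap_comp_toLoc,
      ← RingHom.comp_assoc f B.toLoc, locMap_comp_toLoc, RingHom.comp_assoc])

theorem locMap_id {A : FlaggedRing.{u} (n + 1)} (h : PullsBack (RingHom.id A.carrier)) :
    locMap (RingHom.id A.carrier) h = RingHom.id A.loc.carrier :=
  loc_ringHom_ext (by rw [locMap_comp_toLoc]; rfl)

end HL

theorem IsHLMap.unique : ∀ {n : ℕ} {A B : FlaggedRing.{u} n} {f : A.carrier →+* B.carrier}
    {g g' : A.HL.carrier →+* B.HL.carrier}, IsHLMap f g → IsHLMap f g' → g = g'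
  | 0, _, _, _, _, _, h, h' => h.trans h'.symm
  | _ + 1, A, B, _, _, _, ⟨_, _, h⟩, ⟨_, _, h'⟩ =>
    IsHLMap.unique (A := A.comp.loc) (B := B.comp.loc) h h'

theorem IsHLMap.exists : ∀ {n : ℕ} {A B : FlaggedRing.{u} n} {f : A.carrier →+* B.carrier},
    PullsBack f → A.IsPrincipalChain → B.IsPrincipalChain → ∃ g, IsHLMap f g
  | 0, _, _, f, _, _, _ => ⟨f, rfl⟩
  | _ + 1, A, B, f, hf, hA, hB => by
    have hc := hf.compMap hA hB
    obtain ⟨g, hg⟩ := IsHLMap.exists (A := A.comp.loc) (B := B.comp.loc) (hc.locMap hB.comp)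
      hA.comp.loc hB.comp.loc
    exact ⟨g, hf, hc, hg⟩

theorem IsHLMap.congr_locMap {n : ℕ} {A B : FlaggedRing.{u} (n + 1)}
    {f f' : A.carrier →+* B.carrier} {hf : PullsBack f} {g : A.loc.HL.carrier →+* B.loc.HL.carrier}
    (h : IsHLMap (A := A.loc) (B := B.loc) (locMap f hf) g) (hff' : f = f') (hf' : PullsBack f') :
    IsHLMap (A := A.loc) (B := B.loc) (locMap f' hf') g := by
  subst hff'
  exact h

theorem IsHLMap.comp : ∀ {n : ℕ} {A B C : FlaggedRing.{u} n} {f : A.carrier →+* B.carrier}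
    {f' : B.carrier →+* C.carrier} {g : A.HL.carrier →+* B.HL.carrier}
    {g' : B.HL.carrier →+* C.HL.carrier}, IsHLMap f' g' → IsHLMap f g →
    IsHLMap (f'.comp f) (g'.comp g)
  | 0, _, _, _, _, _, _, _, h', h => by
    cases h
    cases h'
    rfl
  | _ + 1, A, B, C, f, f', g, g', ⟨hf', hc', h'⟩, ⟨hf, hc, h⟩ => by
    have hff := hf'.comp hf
    have heq := compMap_comp hf' hf hff
    have hcc : PullsBack (A := A.comp) (B := C.comp) (compMap (f'.comp f) hff) := by
      rw [heq]
      exact hc'.comp hc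
    have key := IsHLMap.comp (A := A.comp.loc) (B := B.comp.loc) (C := C.comp.loc) h' h
    rw [← locMap_comp hc' hc (hc'.comp hc)] at key
    exact ⟨hff, hcc, key.congr_locMap heq.symm hcc⟩

theorem IsHLMap.id : ∀ {n : ℕ} {A : FlaggedRing.{u} n}, A.IsPrincipalChain →
    IsHLMap (RingHom.id A.carrier) (RingHom.id A.HL.carrier)
  | 0, _, _ => rfl
  | _ + 1, A, hA => by
    have hf : PullsBack (RingHom.id A.carrier) := fun i => Ideal.comap_id _
    have hc : PullsBack (A := A.comp) (B := A.comp) (compMap (RingHom.id A.carrier) hf) := by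
      rw [compMap_id]
      exact fun i => Ideal.comap_id _
    have key := IsHLMap.id (A := A.comp.loc) hA.comp.loc
    rw [← locMap_id (A := A.comp) fun i => Ideal.comap_id _] at key
    exact ⟨hf, hc, key.congr_locMap (compMap_id hf).symm hc⟩

/-! ### The field `HL A` and its discrete place -/

theorem IsPrincipalChain.isField_HL : ∀ {n : ℕ} {A : FlaggedRing.{u} n}, A.IsPrincipalChain →
    IsField A.HL.carrier
  | 0, A, hA => by
    have := hA.isLocalRing
    have h0 : maximalIdeal A.carrier = ⊥ := hA.maximalIdeal_eq.symm.trans hA.ideal_zero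
    have h : IsField A.carrier := isField_iff_maximalIdeal_eq.mpr h0
    exact h
  | _ + 1, A, hA => IsPrincipalChain.isField_HL (A := A.comp.loc) hA.comp.loc

/-- A complete discrete valuation ring with field of fractions `K`, and a surjection onto `k`. -/
structure DiscretePlace (K k : Type u) [CommRing K] [CommRing k] where
  ring : Type u
  [commRing : CommRing ring]
  [isDomain : IsDomain ring]
  [isDiscreteValuationRing : IsDiscreteValuationRing ring]
  [isAdicComplete : IsAdicComplete (maximalIdeal ring) ring]
  incl : ring →+* K
  incl_injective : Function.Injective incl
  exists_mul_eq : ∀ z : K, ∃ a b : ring, b ≠ 0 ∧ z * incl b = incl a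
  proj : ring →+* k
  proj_surjective : Function.Surjective proj

attribute [instance] DiscretePlace.commRing DiscretePlace.isDomain
  DiscretePlace.isDiscreteValuationRing DiscretePlace.isAdicComplete

theorem IsPrincipalChain.isDiscreteValuationRing {A : FlaggedRing.{u} 1}
    (hA : A.IsPrincipalChain) [IsDomain A.carrier] : IsDiscreteValuationRing A.carrier := by
  have := hA.isNoetherianRing
  have := hA.isLocalRing
  obtain ⟨x, hx, hsucc⟩ := hA.exists_succ 0
  rw [Fin.castSucc_zero, hA.ideal_zero] at hx hsucc
  rw [bot_sup_eq, Fin.succ_zero_eq_one] at hsucc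
  have hmax : maximalIdeal A.carrier = Ideal.span {x} := hA.maximalIdeal_eq.symm.trans hsucc
  have hnf : ¬ IsField A.carrier := fun h => hx (by
    rw [← isField_iff_maximalIdeal_eq.mp h, hmax]
    exact Ideal.mem_span_singleton_self x)
  have hprin : (maximalIdeal A.carrier).IsPrincipal := ⟨⟨x, hmax⟩⟩
  exact ((IsDiscreteValuationRing.TFAE A.carrier hnf).out 0 4).mpr hprin

namespace IsQuotientMap

theorem apply_eq_zero {A : FlaggedRing.{u} 1} {C : FlaggedRing.{u} 0}
    {q : A.carrier →+* C.carrier} (hq : IsQuotientMap q) (a : A.carrier)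
    (ha : a ∈ A.ideal (Fin.last 1) ^ 1) : q a = 0 := by
  rw [pow_one] at ha
  exact (hq.ker_eq.symm ▸ ha : a ∈ RingHom.ker q)

/-- The homomorphism from the completion of a flagged ring of length one to its quotient. -/
noncomputable def compProj {A : FlaggedRing.{u} 1} {C : FlaggedRing.{u} 0}
    {q : A.carrier →+* C.carrier} (hq : IsQuotientMap q) : A.comp.carrier →+* C.carrier :=
  (Ideal.Quotient.lift (A.ideal (Fin.last 1) ^ 1) q hq.apply_eq_zero).comp
  (AdicCompletion.evalₐ (A.ideal (Fin.last 1)) 1).toRingHom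

theorem compProj_eq {A : FlaggedRing.{u} 1} {C : FlaggedRing.{u} 0}
    {q : A.carrier →+* C.carrier} (hq : IsQuotientMap q) {x : A.comp.carrier} {a : A.carrier}
    (h : AdicCompletion.evalₐ (A.ideal (Fin.last 1)) 1 x = Ideal.Quotient.mk _ a) :
    hq.compProj x = q a := by
  change Ideal.Quotient.lift _ q hq.apply_eq_zero (AdicCompletion.evalₐ (A.ideal (Fin.last 1)) 1 x) = q a
  rw [h, Ideal.Quotient.lift_mk]

theorem compProj_compMap {A B : FlaggedRing.{u} 1} {C D : FlaggedRing.{u} 0}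
    {q : A.carrier →+* C.carrier} (hq : IsQuotientMap q) {r : B.carrier →+* D.carrier}
    (hr : IsQuotientMap r) {f : A.carrier →+* B.carrier} (hf : PullsBack f)
    {g : C.carrier →+* D.carrier} (h : r.comp f = g.comp q) :
    hr.compProj.comp (FlaggedRing.compMap f hf) = g.comp hq.compProj := by
  refine RingHom.ext fun x => ?_
  obtain ⟨a, ha⟩ := Ideal.Quotient.mk_surjective
    (AdicCompletion.evalₐ (A.ideal (Fin.last 1)) 1 x)
  have h1 : hq.compProj x = q a := hq.compProj_eq ha.symm
  have h2 : hr.compProj (FlaggedRing.compMap f hf x) = r (f a) := hr.compProj_eq (by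
    refine (AdicCompletion.evalₐ_mapRingHom f (hf (Fin.last 1)).ge 1 x).trans ?_
    rw [← ha, Ideal.quotientMap_mk])
  rw [RingHom.comp_apply, RingHom.comp_apply, h1, h2]
  exact RingHom.congr_fun h a

theorem compProj_surjective {A : FlaggedRing.{u} 1} {C : FlaggedRing.{u} 0}
    {q : A.carrier →+* C.carrier} (hq : IsQuotientMap q) : Function.Surjective hq.compProj :=
  fun c => by
    obtain ⟨a, rfl⟩ := hq.surjective c
    obtain ⟨x, hx⟩ := AdicCompletion.surjective_evalₐ (A.ideal (Fin.last 1)) 1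
      (Ideal.Quotient.mk _ a)
    exact ⟨x, hq.compProj_eq hx⟩

/-- The place of `HL A` for a chain of length one. -/
noncomputable def discretePlace {A : FlaggedRing.{u} 1} {C : FlaggedRing.{u} 0}
    {q : A.carrier →+* C.carrier} (hq : IsQuotientMap q) (hA : A.IsPrincipalChain) :
    DiscretePlace A.comp.loc.carrier C.carrier :=
  have := hA.comp.isDomain
  have := hA.comp.isDiscreteValuationRing
  -- In length one the localised prime is `𝔭₀ = ⊥`, so localisation produces the whole field of
  -- fractions.
  have hmem : ∀ {x : A.comp.carrier}, x ∈ A.comp.locSubmonoid ↔ x ≠ 0 := fun {x} => by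
    rw [hA.comp.mem_locSubmonoid]
    change x ∉ A.comp.ideal 0 ↔ _
    rw [hA.comp.ideal_zero, Ideal.mem_bot]
  { ring := A.comp.carrier
    isAdicComplete := hA.comp.maximalIdeal_eq ▸ hA.isAdicComplete_comp
    incl := A.comp.toLoc
    incl_injective := IsLocalization.injective A.comp.loc.carrier (M := A.comp.locSubmonoid)
      fun _ hx => mem_nonZeroDivisors_of_ne_zero (hmem.mp hx)
    exists_mul_eq := fun z => by
      obtain ⟨⟨a, b⟩, h⟩ := IsLocalization.surj A.comp.locSubmonoid z
      exact ⟨a, b, hmem.mp b.2, h⟩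
    proj := hq.compProj
    proj_surjective := hq.compProj_surjective }

theorem compMap_comm {n : ℕ} {A B : FlaggedRing.{u} (n + 1)} {C D : FlaggedRing.{u} n}
    {q : A.carrier →+* C.carrier} (hq : IsQuotientMap q) {r : B.carrier →+* D.carrier}
    (hr : IsQuotientMap r) {f : A.carrier →+* B.carrier} (hf : PullsBack f)
    {g : C.carrier →+* D.carrier} (hg : PullsBack g) (h : r.comp f = g.comp q) :
    hr.compMap.comp (FlaggedRing.compMap f hf) = (FlaggedRing.compMap g hg).comp hq.compMap := by
  have hle : A.ideal (Fin.last (n + 1)) ≤ (D.ideal (Fin.last n)).comap (r.comp f) := by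
    rw [← Ideal.comap_comap, hr.comap_ideal, hf]
    rfl
  have hle' : A.ideal (Fin.last (n + 1)) ≤ (D.ideal (Fin.last n)).comap (g.comp q) := h ▸ hle
  have h1 := AdicCompletion.mapRingHom_comp f hf.le_last r hr.ideal_last_le hle
  have h2 := AdicCompletion.mapRingHom_comp q hq.ideal_last_le g hg.le_last hle'
  exact h1.symm.trans ((AdicCompletion.mapRingHom_congr h hle hle').trans h2)

theorem locMap_comm {n : ℕ} {A B : FlaggedRing.{u} (n + 2)} {C D : FlaggedRing.{u} (n + 1)}
    {q : A.carrier →+* C.carrier} (hq : IsQuotientMap q) {r : B.carrier →+* D.carrier}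
    (hr : IsQuotientMap r) {f : A.carrier →+* B.carrier} (hf : PullsBack f)
    {g : C.carrier →+* D.carrier} (hg : PullsBack g) (h : r.comp f = g.comp q) :
    hr.locMap.comp (FlaggedRing.locMap f hf) = (FlaggedRing.locMap g hg).comp hq.locMap :=
  loc_ringHom_ext (by
    rw [RingHom.comp_assoc, locMap_comp_toLoc, ← RingHom.comp_assoc, locMap, locMap,
      locRingHom_comp_toLoc, RingHom.comp_assoc, RingHom.comp_assoc, locRingHom_comp_toLoc,
      ← RingHom.comp_assoc q C.toLoc, locMap_comp_toLoc, h, RingHom.comp_assoc])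

end IsQuotientMap

/-- Each `loc comp` carries the commutative square of quotient maps to another one, so both lengths
go down together. When `C` has length zero, `Â` is the required discrete valuation ring and the
completed homomorphism is `δ`. -/
theorem IsHLMap.exists_discretePlace : ∀ {n : ℕ} {A B : FlaggedRing.{u} (n + 1)}
    {C D : FlaggedRing.{u} n} {q : A.carrier →+* C.carrier} {r : B.carrier →+* D.carrier}
    {f : A.carrier →+* B.carrier} {g : C.carrier →+* D.carrier}
    {f' : A.HL.carrier →+* B.HL.carrier} {g' : C.HL.carrier →+* D.HL.carrier},
    IsHLMap f f' → IsHLMap g g' → A.IsPrincipalChain → B.IsPrincipalChain → IsQuotientMap q →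
    IsQuotientMap r → r.comp f = g.comp q →
    ∃ (X : DiscretePlace A.HL.carrier C.HL.carrier) (Y : DiscretePlace B.HL.carrier D.HL.carrier)
      (δ : X.ring →+* Y.ring), Y.incl.comp δ = f'.comp X.incl ∧ Y.proj.comp δ = g'.comp X.proj
  | 0, A, B, C, D, q, r, f, g, f', g', ⟨hf, hc, hf'⟩, hg', hA, hB, hq, hr, h => by
    cases hf'
    cases hg'
    exact ⟨hq.discretePlace hA, hr.discretePlace hB, compMap f hf, (locMap_comp_toLoc hc).symm,
      IsQuotientMap.compProj_compMap hq hr hf h⟩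
  | n + 1, A, B, C, D, q, r, f, g, f', g', ⟨hf, hc, hf'⟩, ⟨hg, hd, hg'⟩, hA, hB, hq, hr, h => by
    have hq' := hq.isQuotientMap_compMap hA
    have hr' := hr.isQuotientMap_compMap hB
    exact IsHLMap.exists_discretePlace (A := A.comp.loc) (B := B.comp.loc) (C := C.comp.loc)
      (D := D.comp.loc) hf' hg' hA.comp.loc hB.comp.loc (hq'.isQuotientMap_locMap hA.comp)
      (hr'.isQuotientMap_locMap hB.comp)
      (IsQuotientMap.locMap_comm hq' hr' hc hd (IsQuotientMap.compMap_comm hq hr hf hg h))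

end FlaggedRing

/-! ### Complete discrete valuation rings and their fields of fractions -/

section CompleteDVR

open IsLocalRing

/-- An integer divisible by arbitrarily large integers is zero. -/
theorem WithZero.eq_one_of_forall_exists_eq_pow {z : ℤᵐ⁰} (hz : z ≠ 0)
    (h : ∀ N : ℕ, ∃ n ≥ N, ∃ y, z = y ^ n) : z = 1 := by
  obtain ⟨n, hn, y, hy⟩ := h ((WithZero.log z).natAbs + 1)
  have hlog : WithZero.log z = n * WithZero.log y := by
    rw [hy, WithZero.log_pow, nsmul_eq_mul]
  have h0 : WithZero.log z = 0 := by
    refine Int.eq_zero_of_abs_lt_dvd (m := n) ⟨_, hlog⟩ ?_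
    rw [Int.abs_eq_natAbs]
    omega
  rw [← WithZero.exp_log hz, h0, WithZero.exp_zero]

variable {D : Type*} [CommRing D]

/-- Of the consecutive integers `N` and `N + 1`, one is a unit in a local ring. This covers all
residue characteristics at once. -/
theorem exists_isUnit_natCast_ge [IsLocalRing D] (N : ℕ) : ∃ n ≥ N, IsUnit (n : D) := by
  rcases IsLocalRing.isUnit_or_isUnit_of_isUnit_add (a := ((N + 1 : ℕ) : D)) (b := -(N : D))
    (by push_cast; simp) with h | h
  · exact ⟨N + 1, Nat.le_succ N, h⟩
  · exact ⟨N, le_rfl, by simpa using h.neg⟩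

theorem exists_pow_eq_one_add [IsLocalRing D] [IsAdicComplete (maximalIdeal D) D] {y : D}
    (hy : y ∈ maximalIdeal D) (N : ℕ) : ∃ n ≥ N, ∃ a : D, a ^ n = 1 + y := by
  -- Asking for `N + 1` makes the exponent nonzero. Hensel's lemma is applied to `X ^ n - (1 + y)`
  -- at `1`, where the derivative is the unit `n`.
  obtain ⟨n, hn, hunit⟩ := exists_isUnit_natCast_ge (D := D) (N + 1)
  have hn0 : n ≠ 0 := by omega
  obtain ⟨a, ha, -⟩ := HenselianRing.is_henselian (I := maximalIdeal D)
    (Polynomial.X ^ n - Polynomial.C (1 + y)) (Polynomial.monic_X_pow_sub_C _ hn0) 1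
    (by simpa using hy)
    (by simpa [Polynomial.derivative_X_pow] using hunit.map (Ideal.Quotient.mk (maximalIdeal D)))
  refine ⟨n, by omega, a, ?_⟩
  simpa [sub_eq_zero] using ha

variable [IsDomain D] [IsDiscreteValuationRing D] [IsAdicComplete (maximalIdeal D) D]
  {K : Type*} [Field K] [Algebra D K]

/-- `1 + y` is an `n`-th power for arbitrarily large `n`, so its discrete valuation is trivial; then
`y = (1 + y) - 1` is integral for `w`. -/
theorem valuation_algebraMap_le_one_of_mem (w : Valuation K ℤᵐ⁰) {y : D}
    (hy : y ∈ maximalIdeal D) : w (algebraMap D K y) ≤ 1 := by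
  have hunit : IsUnit (1 + y) := by
    by_contra h
    exact (maximalIdeal.isMaximal D).ne_top ((Ideal.eq_top_iff_one _).mpr
      ((Submodule.add_mem_iff_left _ hy).mp ((mem_maximalIdeal _).mpr h)))
  have h1 : w (algebraMap D K (1 + y)) = 1 := by
    refine WithZero.eq_one_of_forall_exists_eq_pow ?_ fun N => ?_
    · exact (Valuation.ne_zero_iff w).mpr (hunit.map (algebraMap D K)).ne_zero
    · obtain ⟨n, hn, a, ha⟩ := exists_pow_eq_one_add hy N
      exact ⟨n, hn, w (algebraMap D K a), by rw [← ha, map_pow, map_pow]⟩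
  have h2 := w.map_sub (algebraMap D K (1 + y)) 1
  rw [h1, map_one, max_self, map_add, map_one, add_sub_cancel_left] at h2
  exact h2

variable [IsFractionRing D K]

/-- If `w d > 1`, then `π * d ^ k` has value greater than one for large `k`, although it lies in the
maximal ideal. -/
theorem valuation_algebraMap_le_one (w : Valuation K ℤᵐ⁰) (d : D) : w (algebraMap D K d) ≤ 1 := by
  obtain ⟨π, hπ⟩ := IsDiscreteValuationRing.exists_irreducible D
  have hw0 : w (algebraMap D K π) ≠ 0 := (Valuation.ne_zero_iff w).mpr
    ((map_ne_zero_iff _ (IsFractionRing.injective D K)).mpr hπ.ne_zero)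
  by_contra! hlt
  obtain ⟨k, hk⟩ := MulArchimedean.arch (w (algebraMap D K π))⁻¹ hlt
  have h1 : w (algebraMap D K (π * d ^ (k + 1))) ≤ 1 :=
    valuation_algebraMap_le_one_of_mem w (Ideal.mul_mem_right _ _ ((mem_maximalIdeal _).mpr hπ.1))
  rw [map_mul, map_mul, map_pow, map_pow, pow_succ, ← mul_assoc] at h1
  have h2 : 1 ≤ w (algebraMap D K π) * w (algebraMap D K d) ^ k := by
    have := mul_le_mul_right hk (w (algebraMap D K π))
    rwa [mul_inv_cancel₀ hw0] at this
  exact absurd (hlt.trans_le (le_mul_of_one_le_left' h2)) (not_lt_of_ge h1)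

/-- The valuation ring of `w` contains `D`. If `x ∉ D`, then `x⁻¹` is a multiple of the uniformizer
`π`, so `w π < 1` forces `w x > 1`. Completeness for `w` plays no role. -/
theorem valuation_le_one_iff_mem_range {w : Valuation K ℤᵐ⁰} (hw : Function.Surjective w) (x : K) :
    w x ≤ 1 ↔ x ∈ (algebraMap D K).range := by
  refine ⟨fun hx => ?_, ?_⟩
  · by_contra hxr
    obtain ⟨π, hπ⟩ := IsDiscreteValuationRing.exists_irreducible D
    -- If `w π = 1`, every nonzero element of `K`, being a quotient of units times powers of `π`,
    -- has value one, against surjectivity.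
    have hπ1 : w (algebraMap D K π) < 1 := by
      refine lt_of_le_of_ne (valuation_algebraMap_le_one w π) fun h1 => ?_
      have hd : ∀ d : D, d ≠ 0 → w (algebraMap D K d) = 1 := by
        intro d hd
        obtain ⟨n, v, rfl⟩ := IsDiscreteValuationRing.eq_unit_mul_pow_irreducible hd hπ
        have hv : w (algebraMap D K v) = 1 := by
          refine le_antisymm (valuation_algebraMap_le_one w _) ?_
          have h2 : w (algebraMap D K v) * w (algebraMap D K ↑v⁻¹) = 1 := by
            rw [← map_mul, ← map_mul, Units.mul_inv, map_one, map_one]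
          calc (1 : ℤᵐ⁰) = _ := h2.symm
            _ ≤ w (algebraMap D K v) := mul_le_of_le_one_right' (valuation_algebraMap_le_one w _)
        rw [map_mul, map_mul, map_pow, map_pow, h1, hv, one_pow, one_mul]
      obtain ⟨z, hz⟩ := hw (WithZero.exp 1)
      obtain ⟨a, b, hb, rfl⟩ := IsFractionRing.div_surjective (A := D) z
      by_cases ha : a = 0
      · rw [ha, map_zero, zero_div, map_zero] at hz
        exact WithZero.exp_ne_zero hz.symm
      · rw [map_div₀, hd a ha, hd b (nonZeroDivisors.ne_zero hb), div_one, ← WithZero.exp_zero,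
          WithZero.exp_inj] at hz
        exact zero_ne_one hz
    rcases ValuationRing.isInteger_or_isInteger D x with h | ⟨y, hy⟩
    · exact hxr h
    · have hx0 : x ≠ 0 := fun h => hxr (h ▸ zero_mem _)
      have hy0 : ¬ IsUnit y := by
        rintro ⟨v, rfl⟩
        refine hxr ⟨↑v⁻¹, ?_⟩
        rw [← inv_inj, ← hy]
        refine inv_eq_of_mul_eq_one_left ?_
        rw [← map_mul, Units.mul_inv, map_one]
      obtain ⟨c, rfl⟩ := (hπ.maximalIdeal_eq ▸ (mem_maximalIdeal y).mpr hy0 :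
        y ∈ Ideal.span {π}) |> Ideal.mem_span_singleton.mp
      have h3 : w x⁻¹ < 1 := by
        rw [← hy, map_mul, map_mul]
        exact mul_lt_one_of_lt_of_le hπ1 (valuation_algebraMap_le_one w c)
      rw [map_inv₀] at h3
      have hwx : 0 < w x := zero_lt_iff.mpr ((Valuation.ne_zero_iff w).mpr hx0)
      exact absurd ((inv_lt_one₀ hwx).mp h3) (not_lt_of_ge hx)
  · rintro ⟨d, rfl⟩
    exact valuation_algebraMap_le_one w d

-- A Cauchy filter contains sets `M n` with differences in `π ^ n D`. Points `x n` common to `M 0,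
-- …, M n` differ from `x 0` by an `𝔪`-adic Cauchy sequence in `D`; its limit, translated by `x 0`,
-- is the limit of the filter.
open IsDedekindDomain in
theorem completeSpace_valuation_maximalIdeal :
    @CompleteSpace K (Valued.mk' ((IsDiscreteValuationRing.maximalIdeal D).valuation K)).toUniformSpace := by
  set v := (IsDiscreteValuationRing.maximalIdeal D).valuation K with hv
  let _ : Valued K ℤᵐ⁰ := Valued.mk' v
  obtain ⟨π, hπ⟩ := IsDiscreteValuationRing.exists_irreducible D
  have hinj := IsFractionRing.injective D K
  have ht0 : algebraMap D K π ≠ 0 := (map_ne_zero_iff _ hinj).mpr hπ.ne_zero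
  have hle : ∀ d : D, v (algebraMap D K d) ≤ 1 := fun d => HeightOneSpectrum.valuation_le_one _ d
  have hdvd : ∀ (x : K) (n : ℕ), v x < v (algebraMap D K (π ^ n)) →
      ∃ e, x = algebraMap D K (π ^ n * e) := by
    intro x n hx
    have hn0 : algebraMap D K (π ^ n) ≠ 0 := by rw [map_pow]; exact pow_ne_zero _ ht0
    obtain ⟨e, he⟩ := IsDiscreteValuationRing.exists_lift_of_le_one (A := D)
      (x := x / algebraMap D K (π ^ n)) (by
        rw [map_div₀]
        exact div_le_one_of_le₀ hx.le zero_le)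
    exact ⟨e, by rw [map_mul, he, mul_div_cancel₀ _ hn0]⟩
  refine ⟨fun {F} hF => ?_⟩
  obtain ⟨hne, hF⟩ := Valued.cauchy_iff.mp hF
  have hstep : ∀ n : ℕ, ∃ M ∈ F, ∀ x ∈ M, ∀ y ∈ M, ∃ e, y - x = algebraMap D K (π ^ n * e) := by
    intro n
    have hn0 : v.restrict (algebraMap D K (π ^ n)) ≠ 0 := by
      rw [Valuation.ne_zero_iff, map_pow]
      exact pow_ne_zero _ ht0
    obtain ⟨M, hM, h⟩ := hF (Units.mk0 _ hn0)
    exact ⟨M, hM, fun x hx y hy => hdvd _ _ ((Valuation.restrict_lt_iff _).mp (h x hx y hy))⟩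
  choose M hM hdiff using hstep
  have hx : ∀ n : ℕ, ∃ x, ∀ k ≤ n, x ∈ M k := by
    intro n
    obtain ⟨x, hx⟩ := hne.nonempty_of_mem
      ((Filter.biInter_finset_mem (Finset.range (n + 1))).mpr fun k _ => hM k)
    exact ⟨x, fun k hk => Set.mem_iInter₂.mp hx k (by simpa [Nat.lt_succ_iff] using hk)⟩
  choose x hx using hx
  choose d hd using fun n => hdiff 0 (x 0) (hx 0 0 le_rfl) (x n) (hx n 0 n.zero_le)
  simp only [pow_zero, one_mul] at hd
  have hsmod : ∀ (n : ℕ) (a b : D), a ≡ b [SMOD (maximalIdeal D ^ n • ⊤ : Ideal D)] ↔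
      ∃ e, a - b = π ^ n * e := by
    intro n a b
    rw [SModEq.sub_mem, smul_eq_mul, Ideal.mul_top, hπ.maximalIdeal_eq, Ideal.span_singleton_pow,
      Ideal.mem_span_singleton, dvd_def]
  obtain ⟨l, hl⟩ := IsPrecomplete.prec (I := maximalIdeal D) (M := D) inferInstance (f := d) (by
    intro m n hmn
    obtain ⟨e, he⟩ := hdiff m (x n) (hx n m hmn) (x m) (hx m m le_rfl)
    refine (hsmod _ _ _).mpr ⟨e, hinj ?_⟩
    rw [← he, map_sub, ← hd, ← hd]
    ring)
  refine ⟨x 0 + algebraMap D K l, fun s hs => ?_⟩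
  obtain ⟨γ, hγ⟩ := Valued.mem_nhds.mp hs
  have hπ1 : v (algebraMap D K π) < 1 := by
    rw [hv, HeightOneSpectrum.valuation_lt_one_iff_mem]
    exact (mem_maximalIdeal _).mpr hπ.1
  obtain ⟨n, hn⟩ := exists_pow_lt₀ hπ1 (Units.map MonoidWithZeroHom.ValueGroup₀.embedding.toMonoidHom γ)
  refine Filter.mem_of_superset (hM n) fun y hy => hγ ?_
  obtain ⟨e, he⟩ := hdiff n (x n) (hx n n le_rfl) y hy
  obtain ⟨e', he'⟩ := (hsmod _ _ _).mp (hl n)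
  have hy' : y - (x 0 + algebraMap D K l) = algebraMap D K (π ^ n * (e + e')) := by
    rw [mul_add, map_add, ← he, ← he', map_sub, ← hd]
    ring
  rw [Set.mem_ofPred_eq, hy', Valuation.restrict_lt_iff_lt_embedding, map_mul, map_mul, map_pow,
    map_pow]
  exact (mul_le_of_le_one_right' (hle _)).trans_lt hn

end CompleteDVR

theorem isCDVField_of_isFractionRing (D : Type*) [CommRing D] [IsDomain D]
    [IsDiscreteValuationRing D] [IsAdicComplete (IsLocalRing.maximalIdeal D) D]
    (K : Type u) [Field K] [Algebra D K] [IsFractionRing D K] : IsCDVField K :=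
  ⟨_, IsDedekindDomain.HeightOneSpectrum.valuation_surjective K _,
    completeSpace_valuation_maximalIdeal (D := D)⟩

theorem mem_cdvIntegers_iff (D : Type*) [CommRing D] [IsDomain D]
    [IsDiscreteValuationRing D] [IsAdicComplete (IsLocalRing.maximalIdeal D) D]
    {K : Type u} [Field K] [Algebra D K] [IsFractionRing D K] (hK : IsCDVField K) (x : K) :
    x ∈ cdvIntegers K hK ↔ x ∈ (algebraMap D K).range :=
  valuation_le_one_iff_mem_range (Classical.choose_spec hK).1 x

namespace FlaggedRing.DiscretePlace

variable {K k : Type u} [Field K] [CommRing k]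

theorem isFractionRing (X : DiscretePlace K k) : @IsFractionRing X.ring _ K _ X.incl.toAlgebra := by
  let _ : Algebra X.ring K := X.incl.toAlgebra
  have : FaithfulSMul X.ring K := (faithfulSMul_iff_algebraMap_injective _ _).mpr X.incl_injective
  refine IsFractionRing.of_field X.ring K fun z => ?_
  obtain ⟨a, b, hb, h⟩ := X.exists_mul_eq z
  exact ⟨a, b, (eq_div_iff ((map_ne_zero_iff _ X.incl_injective).mpr hb)).mpr h⟩

theorem isCDVField (X : DiscretePlace K k) : IsCDVField K := by
  let _ : Algebra X.ring K := X.incl.toAlgebra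
  have := X.isFractionRing
  exact isCDVField_of_isFractionRing X.ring K

theorem mem_cdvIntegers_iff (X : DiscretePlace K k) (hK : IsCDVField K) (x : K) :
    x ∈ cdvIntegers K hK ↔ x ∈ X.incl.range := by
  let _ : Algebra X.ring K := X.incl.toAlgebra
  have := X.isFractionRing
  exact _root_.mem_cdvIntegers_iff X.ring hK x

end FlaggedRing.DiscretePlace

/-! ### `HL` as a functor to the category of fields of `cdvdim ≥ n` -/

namespace FlaggedRing

open IsLocalRing

namespace DiscretePlace

/-- Replace the field of a discrete place by an isomorphic one. -/
def congr {K K' k : Type u} [CommRing K] [CommRing K'] [CommRing k] (X : DiscretePlace K k)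
    (e : K ≃+* K') : DiscretePlace K' k where
  ring := X.ring
  incl := (e : K →+* K').comp X.incl
  incl_injective := e.injective.comp X.incl_injective
  exists_mul_eq z := by
    obtain ⟨a, b, hb, h⟩ := X.exists_mul_eq (e.symm z)
    refine ⟨a, b, hb, e.symm.injective ?_⟩
    simpa using h
  proj := X.proj
  proj_surjective := X.proj_surjective

variable {K L k l : Type u} [Field K] [Field L] [CommRing k] [CommRing l]

theorem ker_proj (X : DiscretePlace K k) (hk : IsField k) :
    RingHom.ker X.proj = maximalIdeal X.ring := by
  let _ := hk.toField
  exact IsLocalRing.eq_maximalIdeal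
    (RingHom.ker_isMaximal_of_surjective X.proj X.proj_surjective)

theorem isUnit_iff (X : DiscretePlace K k) (hk : IsField k) (d : X.ring) :
    IsUnit d ↔ X.proj d ≠ 0 := by
  rw [← notMem_maximalIdeal, ← X.ker_proj hk, RingHom.mem_ker]

/-- Both `k` and the residue field of `K` are quotients of `X.ring` by its maximal ideal. -/
theorem exists_residueEquiv (X : DiscretePlace K k) (hk : IsField k) (hK : IsCDVField K) :
    ∃ e : k ≃+* CdvResidue K hK, ∀ (d : X.ring) (hd : X.incl d ∈ cdvIntegers K hK),
      e (X.proj d) = residue (cdvIntegers K hK) ⟨X.incl d, hd⟩ := by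
  let ι : X.ring →+* cdvIntegers K hK := X.incl.codRestrict (cdvIntegers K hK).toSubring
    fun d => (X.mem_cdvIntegers_iff hK _).mpr ⟨d, rfl⟩
  have hι : Function.Surjective ι := fun x => by
    obtain ⟨d, hd⟩ := (X.mem_cdvIntegers_iff hK x).mp x.2
    exact ⟨d, Subtype.ext hd⟩
  let ρ : X.ring →+* CdvResidue K hK := (residue (cdvIntegers K hK)).comp ι
  have hρ : Function.Surjective ρ := residue_surjective.comp hι
  have hker : RingHom.ker X.proj ≤ RingHom.ker ρ := by
    rw [X.ker_proj hk, IsLocalRing.eq_maximalIdeal (RingHom.ker_isMaximal_of_surjective ρ hρ)]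
  let ε : k →+* CdvResidue K hK := RingHom.liftOfSurjective X.proj X.proj_surjective ⟨ρ, hker⟩
  have hε : ∀ d, ε (X.proj d) = ρ d := fun d =>
    RingHom.liftOfRightInverse_comp_apply X.proj _ _ ⟨ρ, hker⟩ d
  have hinj : Function.Injective ε := by
    let _ := hk.toField
    exact RingHom.injective ε
  have hsurj : Function.Surjective ε := fun y => by
    obtain ⟨d, rfl⟩ := hρ y
    exact ⟨X.proj d, hε d⟩
  exact ⟨RingEquiv.ofBijective ε ⟨hinj, hsurj⟩, fun d _ => hε d⟩

/-- Suppose `φ x` is integral and `x⁻¹` is the image of `d`. Then `δ d` is a unit, hence nonzero in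
`l`, so `d` is nonzero in `k` and is itself a unit; thus `x` is integral. -/
theorem isCDVMorphism (X : DiscretePlace K k) (Y : DiscretePlace L l) (hk : IsField k)
    (hl : IsField l) (hK : IsCDVField K) (hL : IsCDVField L) {φ : K →+* L} {ψ : k →+* l}
    {δ : X.ring →+* Y.ring} (hφ : Y.incl.comp δ = φ.comp X.incl)
    (hψ : Y.proj.comp δ = ψ.comp X.proj) : IsCDVMorphism hK hL φ := by
  have hφ' : ∀ d, φ (X.incl d) = Y.incl (δ d) := fun d => (RingHom.congr_fun hφ d).symm
  refine SetLike.ext fun x => ?_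
  rw [ValuationSubring.mem_comap, Y.mem_cdvIntegers_iff, X.mem_cdvIntegers_iff]
  constructor
  · rintro ⟨b, hb⟩
    rcases (cdvIntegers K hK).mem_or_inv_mem x with h | h
    · exact (X.mem_cdvIntegers_iff hK x).mp h
    obtain ⟨d, hd⟩ := (X.mem_cdvIntegers_iff hK _).mp h
    by_cases hx : x = 0
    · rw [hx]
      exact zero_mem _
    have hunit : IsUnit (δ d) := by
      refine IsUnit.of_mul_eq_one b (Y.incl_injective ?_)
      rw [map_mul, map_one, hb, ← hφ', hd, ← map_mul, inv_mul_cancel₀ hx, map_one]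
    have hd' : IsUnit d := by
      rw [X.isUnit_iff hk]
      intro h0
      refine (Y.isUnit_iff hl _).mp hunit ?_
      rw [← RingHom.comp_apply, hψ, RingHom.comp_apply, h0, map_zero]
    obtain ⟨c, hc⟩ := hd'.exists_right_inv
    refine ⟨c, ?_⟩
    rw [← inv_inv x, ← hd]
    refine eq_inv_of_mul_eq_one_right ?_
    rw [← map_mul, hc, map_one]
  · rintro ⟨d, rfl⟩
    exact ⟨δ d, (hφ' d).symm⟩

end DiscretePlace

theorem IsQuotientMap.exists_pullsBack {n : ℕ} {A B : FlaggedRing.{u} (n + 1)}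
    {C D : FlaggedRing.{u} n} {q : A.carrier →+* C.carrier} {r : B.carrier →+* D.carrier}
    (hq : IsQuotientMap q) (hr : IsQuotientMap r) {f : A.carrier →+* B.carrier}
    (hf : PullsBack f) : ∃ g : C.carrier →+* D.carrier, PullsBack g ∧ r.comp f = g.comp q := by
  have hker : RingHom.ker q ≤ RingHom.ker (r.comp f) := by
    rw [← RingHom.comap_ker, hr.ker_eq, hf, hq.ker_eq]
  let g : C.carrier →+* D.carrier := RingHom.liftOfSurjective q hq.surjective ⟨r.comp f, hker⟩
  have hg : g.comp q = r.comp f := RingHom.liftOfRightInverse_comp q _ _ ⟨r.comp f, hker⟩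
  refine ⟨g, fun i => ?_, hg.symm⟩
  refine Ideal.comap_injective_of_surjective q hq.surjective ?_
  rw [Ideal.comap_comap, hg, ← Ideal.comap_comap, hr.comap_ideal, hf, hq.comap_ideal]

/-- Stated up to isomorphisms `eA` and `eB` because the induction passes to residue fields, which
are only isomorphic to `HL (A/𝔭₁)` and `HL (B/𝔭₁)`. -/
theorem IsHLMap.isNContinuous : ∀ {n : ℕ} {A B : FlaggedRing.{u} n} {f : A.carrier →+* B.carrier}
    {g : A.HL.carrier →+* B.HL.carrier} {K L : Type u} [Field K] [Field L]
    (eA : A.HL.carrier ≃+* K) (eB : B.HL.carrier ≃+* L) {φ : K →+* L}, A.IsPrincipalChain →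
    B.IsPrincipalChain → PullsBack f → IsHLMap f g →
    φ.comp (eA : A.HL.carrier →+* K) = (eB : B.HL.carrier →+* L).comp g → IsNContinuous n φ
  | 0, _, _, _, _, _, _, _, _, _, _, _, _, _, _, _, _ => trivial
  | n + 1, A, B, f, f', K, L, _, _, eA, eB, φ, hA, hB, hf, hf', hφ => by
    have hq := hA.isQuotientMap_toQuotient
    have hr := hB.isQuotientMap_toQuotient
    have hC := hq.isPrincipalChain hA
    have hD := hr.isPrincipalChain hB
    obtain ⟨g, hg, hfg⟩ := hq.exists_pullsBack hr hf
    obtain ⟨g', hg'⟩ := IsHLMap.exists hg hC hD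
    obtain ⟨X, Y, δ, hincl, hproj⟩ : ∃ (X : DiscretePlace K A.quotient.HL.carrier)
        (Y : DiscretePlace L B.quotient.HL.carrier) (δ : X.ring →+* Y.ring),
        Y.incl.comp δ = φ.comp X.incl ∧ Y.proj.comp δ = g'.comp X.proj := by
      obtain ⟨X, Y, δ, hδ, hδ'⟩ := hf'.exists_discretePlace hg' hA hB hq hr hfg
      refine ⟨X.congr eA, Y.congr eB, δ, ?_, hδ'⟩
      change ((eB : B.HL.carrier →+* L).comp Y.incl).comp δ =
        φ.comp ((eA : A.HL.carrier →+* K).comp X.incl)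
      rw [RingHom.comp_assoc, hδ, ← RingHom.comp_assoc, ← hφ, RingHom.comp_assoc]
    have hK := X.isCDVField
    have hL := Y.isCDVField
    have hi := X.isCDVMorphism Y hC.isField_HL hD.isField_HL hK hL hincl hproj
    obtain ⟨eC, heC⟩ := X.exists_residueEquiv hC.isField_HL hK
    obtain ⟨eD, heD⟩ := Y.exists_residueEquiv hD.isField_HL hL
    refine ⟨hK, hL, hi, IsHLMap.isNContinuous eC eD hC hD hg hg' (RingHom.ext fun z => ?_)⟩
    obtain ⟨d, rfl⟩ := X.proj_surjective z
    have hd := (X.mem_cdvIntegers_iff hK _).mpr ⟨d, rfl⟩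
    have hd' := (Y.mem_cdvIntegers_iff hL _).mpr ⟨δ d, rfl⟩
    change cdvResidueMap φ hi (eC (X.proj d)) = eD (g' (X.proj d))
    rw [heC d hd, ← RingHom.comp_apply g', ← hproj, RingHom.comp_apply, heD _ hd']
    refine congrArg (residue (cdvIntegers L hL)) (Subtype.ext ?_)
    exact (RingHom.congr_fun hincl d).symm

end FlaggedRing

/-- Applied to the identity of `HL A`, this yields the bound on `cdvdim`. -/
theorem IsNContinuous.hasResidueTower : ∀ {n : ℕ} {F L : Type u} [Field F] [Field L]
    {i : F →+* L}, IsNContinuous n i → HasResidueTower n F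
  | 0, _, _, _, _, _, _ => trivial
  | _ + 1, _, _, _, _, _, ⟨hF, _, _, h⟩ => ⟨hF, h.hasResidueTower⟩

namespace RegularChainCat

variable {n : ℕ}

theorem isPrincipalChain (A : RegularChainCat.{u} n) : A.toFlaggedRing.IsPrincipalChain :=
  A.isRegularChain.isPrincipalChain

theorem Hom.exists_isHLMap {A B : RegularChainCat.{u} n} (f : Hom A B) :
    ∃ g, FlaggedRing.IsHLMap f.hom g :=
  FlaggedRing.IsHLMap.exists f.pullsBack A.isPrincipalChain B.isPrincipalChain

/-- The field `HL A` attached to a regular chain `A`. -/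
noncomputable def HLObj (A : RegularChainCat.{u} n) : CdvFieldCat.{u} n :=
  letI field : Field A.toFlaggedRing.HL.carrier := A.isPrincipalChain.isField_HL.toField
  { carrier := A.toFlaggedRing.HL.carrier
    field := field
    le_cdvdim := (le_cdvdim_iff n _).mpr <| IsNContinuous.hasResidueTower <|
      (FlaggedRing.IsHLMap.id A.isPrincipalChain).isNContinuous (RingEquiv.refl _) (RingEquiv.refl _)
        A.isPrincipalChain A.isPrincipalChain (fun _ => Ideal.comap_id _) rfl }

/-- The functor `HL` from regular `n`-chains to fields of `cdvdim ≥ n`. -/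
noncomputable def HLFunctor (n : ℕ) : RegularChainCat.{u} n ⥤ CdvFieldCat.{u} n where
  obj A := A.HLObj
  map {A B} f :=
    { hom := f.exists_isHLMap.choose
      nContinuous := f.exists_isHLMap.choose_spec.isNContinuous (K := A.HLObj.carrier)
        (L := B.HLObj.carrier) (RingEquiv.refl _) (RingEquiv.refl _) A.isPrincipalChain
        B.isPrincipalChain f.pullsBack rfl }
  map_id A := CdvFieldCat.Hom.ext <| (Hom.exists_isHLMap (𝟙 A)).choose_spec.unique
    (FlaggedRing.IsHLMap.id A.isPrincipalChain)
  map_comp f g := CdvFieldCat.Hom.ext <| (Hom.exists_isHLMap (f ≫ g)).choose_spec.unique <|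
    g.exists_isHLMap.choose_spec.comp f.exists_isHLMap.choose_spec

end RegularChainCat

/-- The isomorphisms `e` tie the objects of `F` to `HL`. In the equivalence, the backward direction
says that `HL f` exists, with all its pullback conditions, and is given by `F`; the forward
direction is its uniqueness. -/
theorem mainTheorem5 (n : ℕ) :
    ∃ (F : RegularChainCat.{u} n ⥤ CdvFieldCat.{u} n)
      (e : ∀ A : RegularChainCat.{u} n, A.toFlaggedRing.HL.carrier ≃+* (F.obj A).carrier),
      ∀ (A B : RegularChainCat.{u} n) (f : A ⟶ B)
        (g : A.toFlaggedRing.HL.carrier →+* B.toFlaggedRing.HL.carrier),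
        FlaggedRing.IsHLMap f.hom g ↔
          g = ((e B).symm : (F.obj B).carrier →+* B.toFlaggedRing.HL.carrier).comp
            ((F.map f).hom.comp (e A : A.toFlaggedRing.HL.carrier →+* (F.obj A).carrier)) := by
  refine ⟨RegularChainCat.HLFunctor n, fun A => RingEquiv.refl A.toFlaggedRing.HL.carrier,
    fun A B f g => ⟨fun h => h.unique f.exists_isHLMap.choose_spec, fun h => ?_⟩⟩
  rw [h]
  exact f.exists_isHLMap.choose_spec
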